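/- Let $d,n\ge 1$. A generalized chord diagram on $N$ points is a partition of $N$ points, placed on a circle and numbered in circular order, into sets of $d$ points each ("chords", thought of as copies of $K_d$). It is loopless if no two neighbouring points of the circle belong to the same chord. The cyclic group $C_N$ of rotations acts on these diagrams; for $m\mid N$ a diagram is $m$-symmetric if it is invariant under the rotation by $N/m$ points. Let $f(dn,m)$ be the number of $m$-symmetric loopless diagrams on $dn$ points, and let $\tilde b_n^{(d)}$ be the number of loopless diagrams on $dn$ points up to rotation. For $m\ge1$, $v\ge 0$, let $\tilde a_{v,k}^{(m,d)}$ be the number of generalized $m$-linear diagrams with exactly $k$ loops in each sector, that is, of $m$-symmetric diagrams (loops allowed) on $mv$ points such that, after the circle is cut into the $m$ sectors $\{iv+1,\dots,(i+1)v\}$, $0\le i<m$, each sector contains exactly $k$ pairs of consecutive points of that sector lying on the same chord; put $\tilde a_{v,k}^{(m,d)}=0$ for $v<0$. Given integers $l,v,e,k$, define the numbers $q_{\kappa,j}$ ($j\ge 0$, $\kappa\in\mathbb Z$) by $q_{0,0}=1$, $q_{\kappa,j}=0$ if $\kappa<0$ or $\kappa>j$, and, for $0\le\kappa\le j+1$,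 $$q_{\kappa,j+1}=[2j+k-(\kappa-1)]\,q_{\kappa-1,j}+(\kappa+1)(l-1)\,q_{\kappa+1,j}+[\,l(v-e+j+1)-(2j-\kappa+k)-\kappa(l-1)\,]\,q_{\kappa,j},$$ and, for $w\ge 0$, $$\tilde p_{w}=\tilde p_{w}(l,v,e,k)=\sum_{i=0}^{w}\sum_{j=0}^{w-i}(-1)^{i+j}\frac{w!}{(w-i-j)!}\,q_{0,\,w-i-j}.$$ Then: (a) for every $m\mid dn$, every rotation of order $m$ in $C_{dn}$ fixes exactly $f(dn,m)$ loopless diagrams on $dn$ points; (b) $\displaystyle \tilde b_n^{(d)}=\frac1{dn}\sum_{m\mid dn}\phi(m)\,f(dn,m)$, where $\phi$ is Euler's function; (c) if $n\ge 2$, then for every $m\mid dn$, with $v=dn/m$, $$f(dn,m)=\tilde a_{v,0}^{(m,d)}-\sum_{\substack{l\mid m\\ m\mid ld}}\ \sum_{k=0}^{\tilde d-2}\frac{l^k}{(\tilde d-2-k)!}\;\tilde p_{\tilde d-2-k}(l,v,\tilde d,k)\;\tilde a_{v-\tilde d,k}^{(m,d)},\qquad \tilde d=\frac{ld}{m}$$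 (the inner sum being empty if $\tilde d=1$). -/

import Mathlib

/-- A generalized chord diagram on `N` points of a circle, numbered `0, …, N - 1` in circular
order: a partition of the points into chords, each chord (a copy of `K_d`) having `d` points.
`D.rel x y` says that `x` and `y` lie on the same chord. Loops are allowed. -/
@[ext]
structure ChordDiagram (N d : ℕ) where
  rel : Setoid (Fin N)
  card_chord : ∀ x : Fin N, {y : Fin N | rel x y}.ncard = d

/-- Permutations of the points act on diagrams by transport. -/
instance ChordDiagram.instMulAction (N d : ℕ) :
    MulAction (Equiv.Perm (Fin N)) (ChordDiagram N d) where
  smul g D :=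
    { rel := D.rel.comap (g⁻¹ : Equiv.Perm (Fin N))
      card_chord := fun x => by
        have h := Set.ncard_preimage_of_injective_subset_range
          (s := {y : Fin N | D.rel ((g⁻¹ : Equiv.Perm (Fin N)) x) y})
          (g⁻¹ : Equiv.Perm (Fin N)).injective
          (by rw [(g⁻¹ : Equiv.Perm (Fin N)).surjective.range_eq]; exact Set.subset_univ _)
        exact h.trans (D.card_chord _) }
  one_smul D := rfl
  mul_smul g h D := by
    apply ChordDiagram.ext
    change D.rel.comap ((g * h)⁻¹ : Equiv.Perm (Fin N)) = _
    rw [mul_inv_rev]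
    rfl

/-- The cyclic group `C_N` of rotations of the circle, generated by `x ↦ x + 1 (mod N)`. -/
def rotationGroup (N : ℕ) : Subgroup (Equiv.Perm (Fin N)) :=
  Subgroup.zpowers (finRotate N)

/-- No chord joins two neighbouring points of the circle. -/
def ChordDiagram.IsLoopless {N d : ℕ} (D : ChordDiagram N d) : Prop :=
  ∀ x : Fin N, finRotate N x ≠ x → ¬ D.rel x (finRotate N x)

/-- The diagram is invariant under the rotation by `N / m` points (used for `m ∣ N`). -/
def ChordDiagram.IsSymmetric {N d : ℕ} (D : ChordDiagram N d) (m : ℕ) : Prop :=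
  (finRotate N ^ (N / m)) • D = D

/-- The number of loopless generalized chord diagrams with `d * n` points up to rotation. -/
noncomputable def numUpToRotation (n d : ℕ) : ℕ :=
  Nat.card (Quotient ((MulAction.orbitRel (rotationGroup (d * n)) (ChordDiagram (d * n) d)).comap
    (Subtype.val : {D : ChordDiagram (d * n) d // D.IsLoopless} → ChordDiagram (d * n) d)))

/-- `f(N, m)`: the number of `m`-symmetric loopless generalized chord diagrams on `N` points. -/
noncomputable def numSymmetricLoopless (d N m : ℕ) : ℕ :=
  Nat.card {D : ChordDiagram N d // D.IsLoopless ∧ D.IsSymmetric m}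

/-- The number of loops in sector `s` (the points `s * v, …, s * v + v - 1`) after the circle has
been cut into sectors of `v` points: pairs of consecutive points of the sector on one chord. -/
noncomputable def ChordDiagram.sectorLoops {N d : ℕ} (D : ChordDiagram N d) (v s : ℕ) : ℕ :=
  {i : ℕ | i + 1 < v ∧ ∃ x y : Fin N,
    (x : ℕ) = s * v + i ∧ (y : ℕ) = s * v + i + 1 ∧ D.rel x y}.ncard

/-- The number of generalized `m`-linear diagrams with chords `K_d`, with `v` points and exactly
`k` loops in each of the `m` sectors; it is `0` for negative `v`. -/
noncomputable def numLinear (m d : ℕ) (v : ℤ) (k : ℕ) : ℕ :=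
  if 0 ≤ v then
    Nat.card {D : ChordDiagram (m * v.toNat) d //
      D.IsSymmetric m ∧ ∀ s < m, D.sectorLoops v.toNat s = k}
  else 0

/-- The numbers `q_{κ, j}` with parameters `l` (number of cliques), `v` (points in a sector),
`e` (clique points in a sector), `k` (loops), given by their recurrence on `j`. -/
def qNum (l v e k : ℤ) : ℕ → ℤ → ℤ
  | 0, κ => if κ = 0 then 1 else 0
  | j + 1, κ =>
    if κ < 0 ∨ (j : ℤ) + 1 < κ then 0
    else
      (2 * j + k - (κ - 1)) * qNum l v e k j (κ - 1)
        + (κ + 1) * (l - 1) * qNum l v e k j (κ + 1)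
        + (l * (v - e + j + 1) - (2 * j - κ + k) - κ * (l - 1)) * qNum l v e k j κ

/-- The inclusion–exclusion number obtained from `q_{0, w}, …, q_{0, 0}` by allowing for the two
end points of a sector. -/
def pNum (l v e k : ℤ) (w : ℕ) : ℚ :=
  ∑ i ∈ Finset.range (w + 1), ∑ j ∈ Finset.range (w - i + 1),
    (-1 : ℚ) ^ (i + j) * ((w.factorial : ℚ) / ((w - i - j).factorial : ℚ))
      * (qNum l v e k (w - i - j) 0 : ℚ)

/-! Parts (a) and (b) are group theory. A cyclic group has one subgroup of each order, so rotations
of equal order fix the same diagrams. Burnside's lemma, with group elements sorted by order, then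
gives (b).

For (c), an `m`-symmetric diagram is read as a translation-invariant partition of `ZMod m × Fin v`
(`symDiagramEquiv`). It is loopless iff it has no loop inside a sector and the last point of sector
`0` is not joined to the first point of sector `1` (`isLoopless_iff`). So `f` is the number of
diagrams without sector loops, minus the number of those with a boundary loop.

To count the latter, take the chord through the first point, with stabiliser `H` of index `l` in
`ZMod m`. Its `l` translates occupy `e` positions of each sector, where `e * |H| = d`, so `e =
ld/m`. Label these positions by cosets of `H` and the others by `none`. The diagram is equivalent to
this word together with the symmetric diagram on the remaining `V = v - e` positions (`fitsEquiv`).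
The smaller diagram may have some number `k` of loops. The conditions on the large diagram say that
the word separates the two points of each of these loops, has no equal adjacent labels, starts with
`0` and ends with `-1` (`loops_and_boundary_iff`).

Reading such words letter by letter gives the generating function `X^(V+1) (lX)^k (1+X)^(V-1-k) /
(1-(l-1)X)^(V+1)` when `V > 0`. On the other side, the recurrence for `q` has a closed form whose
exponential generating function at `κ = 0` is `(1+X)^(V+1-k) / (1-(l-1)X)^(V+1)`, and passing from
`q` to `p` divides by `(1+X)^2`. Hence `wordSeries_some_eq`, and the coefficients are those of (c).
Subgroups of `ZMod m` correspond to divisors `l` of `m`, which gives the outer sum. -/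

/-! ### The numbers `q` and `p`: closed form and exponential generating functions -/

open Polynomial in
/-- Closed form of the polynomial `∑ κ, q_{κ, j} y ^ κ`. -/
noncomputable def qPoly (l V k j : ℕ) : ℤ[X] :=
  ∑ ij ∈ Finset.HasAntidiagonal.antidiagonal j, (j.choose ij.1 : ℤ[X]) *
    (C (((V + 1 - k).descFactorial ij.1 : ℤ) * ((V + 1).ascFactorial ij.2 : ℤ))
      * ((1 - X) ^ ij.1 * (X + C ((l : ℤ) - 1)) ^ ij.2))

-- Multiplication by `1 - X` or `X + l - 1` turns differentiation of the matching power into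
-- multiplication by its exponent. Both sides are therefore one summand times the same linear factor
-- `(V+1+r)(X+l-1) + (V+1-k-i)(1-X)`.
open Polynomial in
lemma qPoly_term_aux (l V k i r : ℕ) (hk : k ≤ V + 1) :
    (C (((V + 1 - k).descFactorial i : ℤ) * ((V + 1).ascFactorial (r + 1) : ℤ))
      * ((1 - X) ^ i * (X + C ((l : ℤ) - 1)) ^ (r + 1)))
    + (C (((V + 1 - k).descFactorial (i + 1) : ℤ) * ((V + 1).ascFactorial r : ℤ))
      * ((1 - X) ^ (i + 1) * (X + C ((l : ℤ) - 1)) ^ r))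
    = (C ((l : ℤ) * (V + (i + r : ℕ) + 1)) + C (2 * ((i + r : ℕ) : ℤ) + k) * (X - 1)) *
      (C (((V + 1 - k).descFactorial i : ℤ) * ((V + 1).ascFactorial r : ℤ))
      * ((1 - X) ^ i * (X + C ((l : ℤ) - 1)) ^ r))
      + (1 - X) * (X + C ((l : ℤ) - 1)) *
        derivative (C (((V + 1 - k).descFactorial i : ℤ) * ((V + 1).ascFactorial r : ℤ))
      * ((1 - X) ^ i * (X + C ((l : ℤ) - 1)) ^ r)) := by
  have h1 : ((V + 1 - k).descFactorial (i + 1) : ℤ)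
      = ((V : ℤ) + 1 - k - i) * ((V + 1 - k).descFactorial i : ℤ) := by
    rw [Nat.descFactorial_succ]
    -- Beyond `V + 1 - k` the natural subtraction is no longer faithful, but both falling factorials
    -- vanish.
    rcases le_or_gt i (V + 1 - k) with h | h
    · push_cast [h, hk]; ring
    · rw [Nat.descFactorial_of_lt h]; simp
  have h2 : ((V + 1).ascFactorial (r + 1) : ℤ) = ((V : ℤ) + 1 + r) * (V + 1).ascFactorial r := by
    rw [Nat.ascFactorial_succ]; push_cast; ring
  have hd1 : (1 - X : ℤ[X]) * derivative ((1 - X : ℤ[X]) ^ i) = - (i : ℤ[X]) * (1 - X) ^ i := by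
    rcases i with _ | i
    · simp
    · rw [derivative_pow_succ]; simp; ring
  have hd2 : (X + C ((l : ℤ) - 1) : ℤ[X]) * derivative ((X + C ((l : ℤ) - 1) : ℤ[X]) ^ r)
      = (r : ℤ[X]) * (X + C ((l : ℤ) - 1)) ^ r := by
    rcases r with _ | r
    · simp
    · rw [derivative_pow_succ, derivative_add, derivative_X, derivative_C]
      simp only [Nat.cast_add, map_add, map_natCast, map_one, Nat.cast_one]; ring
  rw [derivative_C_mul, derivative_mul, h1, h2]
  generalize ((V + 1 - k).descFactorial i : ℤ) = a
  generalize ((V + 1).ascFactorial r : ℤ) = b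
  generalize hα : (1 - X : ℤ[X]) ^ i = s at *
  generalize hβ : (X + C ((l : ℤ) - 1) : ℤ[X]) ^ r = u at *
  rw [pow_succ, pow_succ, hα, hβ]
  simp only [map_mul, map_add, map_sub, map_natCast, map_one, Nat.cast_add, map_ofNat] at *
  linear_combination (-C a * C b * (X + ((l : ℤ[X]) - 1)) * u) * hd1 - (C a * C b * s * (1 - X)) * hd2

-- This is the recurrence of `qNum` as a differential recurrence in the variable marking `κ`.
-- Pascal's rule splits the sum so that it holds summand by summand.
open Polynomial in
lemma qPoly_succ (l V k j : ℕ) (hk : k ≤ V + 1) :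
    qPoly l V k (j + 1) = (C ((l : ℤ) * (V + j + 1)) + C (2 * (j : ℤ) + k) * (X - 1)) *
      qPoly l V k j + (1 - X) * (X + C ((l : ℤ) - 1)) * derivative (qPoly l V k j) := by
  unfold qPoly
  rw [Finset.sum_antidiagonal_choose_succ_mul (fun i r : ℕ =>
    (C (((V + 1 - k).descFactorial i : ℤ) * ((V + 1).ascFactorial r : ℤ))
      * ((1 - X) ^ i * (X + C ((l : ℤ) - 1)) ^ r) : ℤ[X])), ← Finset.sum_add_distrib,
    derivative_sum, Finset.mul_sum, Finset.mul_sum, ← Finset.sum_add_distrib]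
  refine Finset.sum_congr rfl fun ij hij => ?_
  obtain ⟨i, r⟩ := ij
  obtain rfl : i + r = j := by simpa using hij
  -- The two halves of Pascal's rule carry the coefficients `choose j i` and `choose j r`, which are
  -- equal.
  rw [Nat.choose_symm_of_eq_add (n := i + r) (a := r) (b := i) (by ring)]
  rw [← mul_add, qPoly_term_aux l V k i r hk]
  rw [← C_eq_natCast (R := ℤ)]
  simp only [derivative_C_mul]
  push_cast
  ring

open Polynomial in
lemma natDegree_qPoly_le (l V k j : ℕ) : (qPoly l V k j).natDegree ≤ j := by
  unfold qPoly
  refine natDegree_sum_le_of_forall_le _ _ fun ij hij => ?_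
  have : ij.1 + ij.2 = j := by simpa using hij
  have h1 : ((1 - X : ℤ[X]) ^ ij.1).natDegree ≤ ij.1 := by compute_degree
  have h2 : ((X + C ((l : ℤ) - 1) : ℤ[X]) ^ ij.2).natDegree ≤ ij.2 := by compute_degree
  rw [← C_eq_natCast (R := ℤ)]
  refine (natDegree_C_mul_le _ _).trans ((natDegree_C_mul_le _ _).trans (natDegree_mul_le.trans ?_))
  omega

lemma qNum_of_neg (l v e k : ℤ) (j : ℕ) {κ : ℤ} (h : κ < 0) : qNum l v e k j κ = 0 := by
  cases j with
  | zero => simp [qNum]; omega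
  | succ j => simp [qNum, h]

open Polynomial in
lemma qNum_eq_coeff (l V k : ℕ) (hk : k ≤ V + 1) (v e : ℤ) (hV : v - e = V) (j κ : ℕ) :
    qNum l v e k j κ = (qPoly l V k j).coeff κ := by
  induction j generalizing κ with
  | zero =>
    simp only [qNum, qPoly]
    simp [coeff_one]
  | succ j ih =>
    rw [qNum]
    split_ifs with h
    -- The cutoff in the recurrence is the degree bound.
    · rw [coeff_eq_zero_of_natDegree_lt]
      have := natDegree_qPoly_le l V k (j + 1)
      omega
    · have hx : (κ : ℤ) + 1 = ((κ + 1 : ℕ) : ℤ) := by push_cast; rfl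
      have e1 : qPoly l V k (j + 1) = C ((l : ℤ) * (V + j + 1) - (2 * j + k)) * qPoly l V k j
          + C (2 * (j : ℤ) + k) * (X * qPoly l V k j)
          + C ((l : ℤ) - 1) * derivative (qPoly l V k j)
          + C (2 - (l : ℤ)) * (X * derivative (qPoly l V k j))
          - X * (X * derivative (qPoly l V k j)) := by
        rw [qPoly_succ l V k j hk]
        simp only [map_mul, map_add, map_sub, map_natCast, map_one, map_ofNat]; ring
      rw [e1, hx, ih, ih]
      rcases κ with _ | κ
      · rw [qNum_of_neg _ _ _ _ _ (by simp)]
        simp only [coeff_sub, coeff_add, coeff_C_mul, coeff_X_mul_zero, coeff_derivative]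
        push_cast
        rw [show v - e + j + 1 = (V : ℤ) + j + 1 by rw [hV]]
        ring
      · have h0 : ((κ + 1 : ℕ) : ℤ) - 1 = (κ : ℤ) := by push_cast; ring
        rw [h0, ih, show v - e + j + 1 = (V : ℤ) + j + 1 by rw [hV]]
        simp only [coeff_sub, coeff_add, coeff_C_mul, coeff_X_mul, coeff_derivative]
        rcases κ with _ | κ
        · simp only [coeff_X_mul_zero]; push_cast; ring
        · simp only [coeff_X_mul, coeff_derivative]; push_cast; ring

lemma qNum_zero_eq_sum (l V k : ℕ) (hk : k ≤ V + 1) (v e : ℤ) (hV : v - e = V) (j : ℕ) :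
    (qNum l v e k j 0 : ℚ) / (j.factorial : ℚ) = ∑ ij ∈ Finset.HasAntidiagonal.antidiagonal j,
      ((V + 1 - k).choose ij.1 : ℚ) * (((V + ij.2).choose ij.2 : ℚ) * ((l : ℚ) - 1) ^ ij.2) := by
  have h := qNum_eq_coeff l V k hk v e hV j 0
  rw [Nat.cast_zero, Polynomial.coeff_zero_eq_eval_zero, qPoly, Polynomial.eval_finsetSum] at h
  rw [h]
  push_cast
  rw [Finset.sum_div]
  refine Finset.sum_congr rfl fun ij hij => ?_
  obtain ⟨i, r⟩ := ij
  obtain rfl : i + r = j := by simpa using hij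
  simp only [Polynomial.eval_mul, Polynomial.eval_natCast, Polynomial.eval_C, Polynomial.eval_pow,
    Polynomial.eval_sub, Polynomial.eval_add, Polynomial.eval_X, Polynomial.eval_one]
  rw [Nat.descFactorial_eq_factorial_mul_choose, Nat.ascFactorial_eq_factorial_mul_choose]
  have := Nat.add_choose_mul_factorial_mul_factorial i r
  have h2 : ((i + r).factorial : ℚ) ≠ 0 := by positivity
  rw [div_eq_iff h2, ← this]
  push_cast
  rw [Nat.choose_symm_add (a := i) (b := r)]
  simp only [one_pow, one_mul, zero_add]
  ring

open PowerSeries in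
lemma mk_choose_mul_pow (V : ℕ) (c : ℚ) :
    (PowerSeries.mk fun r => ((V + r).choose r : ℚ) * c ^ r) * (1 - C c * X) ^ (V + 1) = 1 := by
  have h : (PowerSeries.mk fun r => ((V + r).choose V : ℚ)) * (1 - X) ^ (V + 1) = 1 := by
    rw [← mk_one_pow_eq_mk_choose_add, ← mul_pow, mk_one_mul_one_sub_eq_one, one_pow]
  have h2 := congrArg (rescale c) h
  rw [map_mul, map_pow, map_sub, map_one, rescale_X] at h2
  rw [show (PowerSeries.mk fun r => ((V + r).choose r : ℚ) * c ^ r)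
      = rescale c (PowerSeries.mk fun r => ((V + r).choose V : ℚ)) from ?_, h2]
  ext r
  simp only [coeff_mk, coeff_rescale]
  rw [Nat.choose_symm_add]; ring

open PowerSeries in
lemma mk_choose_eq_one_add_X_pow (A : ℕ) :
    (PowerSeries.mk fun i => (A.choose i : ℚ)) = (1 + X) ^ A := by
  ext i
  rw [coeff_mk]
  have : ((1 + X : ℚ⟦X⟧) ^ A) = (((1 + Polynomial.X) ^ A : Polynomial ℚ) : ℚ⟦X⟧) := by
    push_cast; rfl
  rw [this, Polynomial.coeff_coe, Polynomial.coeff_one_add_X_pow]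

-- At `y = 0` the closed form is a convolution of a binomial and a negative binomial series.
open PowerSeries in
lemma qSeries_mul (l V k : ℕ) (hk : k ≤ V + 1) (v e : ℤ) (hV : v - e = V) :
    (PowerSeries.mk fun j => (qNum l v e k j 0 : ℚ) / (j.factorial : ℚ))
      * (1 - C ((l : ℚ) - 1) * X) ^ (V + 1) = (1 + X) ^ (V + 1 - k) := by
  have : (PowerSeries.mk fun j => (qNum l v e k j 0 : ℚ) / (j.factorial : ℚ))
      = (PowerSeries.mk fun i => ((V + 1 - k).choose i : ℚ)) *
        (PowerSeries.mk fun r => ((V + r).choose r : ℚ) * ((l : ℚ) - 1) ^ r) := by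
    ext j
    rw [coeff_mk, qNum_zero_eq_sum l V k hk v e hV, coeff_mul]
    simp
  rw [this, mul_assoc, mk_choose_mul_pow, mul_one, mk_choose_eq_one_add_X_pow]

open PowerSeries in
/-- The exponential generating function of the inclusion–exclusion numbers. -/
noncomputable def pSeries (l v e k : ℤ) : ℚ⟦X⟧ :=
  PowerSeries.mk fun w => pNum l v e k w / (w.factorial : ℚ)

-- The alternating double sum in `pNum` is multiplication by the geometric series `1 / (1 + X)`
-- twice.
open PowerSeries in
lemma pSeries_mul (l v e k : ℤ) :
    pSeries l v e k * (1 + X) ^ 2 =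
      PowerSeries.mk fun j => (qNum l v e k j 0 : ℚ) / (j.factorial : ℚ) := by
  set Q : ℚ⟦X⟧ := PowerSeries.mk fun j => (qNum l v e k j 0 : ℚ) / (j.factorial : ℚ) with hQ
  set G : ℚ⟦X⟧ := PowerSeries.mk fun i => (-1 : ℚ) ^ i with hG
  have hG1 : G * (1 + X) = 1 := by
    have h := congrArg (rescale (-1 : ℚ)) (mk_one_mul_one_sub_eq_one ℚ)
    rw [map_mul, map_sub, map_one, rescale_X] at h
    rw [show G = rescale (-1 : ℚ) (PowerSeries.mk 1) from ?_,
      show (1 + X : ℚ⟦X⟧) = 1 - C (-1 : ℚ) * X by simp, h]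
    ext i
    simp [hG, coeff_rescale]
  have hP : pSeries l v e k = G * (G * Q) := by
    ext w
    rw [pSeries, coeff_mk, coeff_mul, Finset.Nat.sum_antidiagonal_eq_sum_range_succ_mk, pNum,
      Finset.sum_div]
    refine Finset.sum_congr rfl fun i _ => ?_
    rw [coeff_mul, Finset.Nat.sum_antidiagonal_eq_sum_range_succ_mk, Finset.sum_div,
      Finset.mul_sum]
    refine Finset.sum_congr rfl fun j _ => ?_
    simp only [hG, hQ, coeff_mk]
    have : (w.factorial : ℚ) ≠ 0 := by positivity
    rw [pow_add]
    field_simp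
  calc pSeries l v e k * (1 + X) ^ 2 = (G * (1 + X)) * (G * (1 + X)) * Q := by rw [hP]; ring
    _ = Q := by rw [hG1]; ring

/-! ### Admissible words and their generating functions -/

/-- `WordOk t bs p ws`: the word `ws` may follow the letter `p`. A letter `none` is a point off the
clique and `some a` is a clique point with label `a`. The flags `bs` tell, for each `none` still to
come, whether it forms a loop with the `none` before it; such a pair may not become adjacent,
equal labels may not be adjacent, and the last letter must be `some t`. -/
def WordOk {L : Type*} (t : L) : List Bool → Option L → List (Option L) → Prop
  | bs, p, [] => bs = [] ∧ p = some t
  | [], _, none :: _ => False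
  | b :: bs, p, none :: ws => (p = none → b = false) ∧ WordOk t bs none ws
  | bs, p, some a :: ws => p ≠ some a ∧ WordOk t bs (some a) ws

/-- The number of admissible words of length `n`. -/
noncomputable def wordCount {L : Type*} (t : L) (bs : List Bool) (p : Option L) (n : ℕ) : ℕ :=
  Nat.card {ws : List (Option L) // ws.length = n ∧ WordOk t bs p ws}

lemma finite_words {A : Type*} [Finite A] (n : ℕ) (P : List A → Prop) :
    Finite {ws : List A // ws.length = n ∧ P ws} :=
  ((List.finite_length_eq A n).subset fun _ h => h.1).to_subtype

lemma card_words_succ {A : Type*} [Fintype A] (n : ℕ) (P : List A → Prop) :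
    Nat.card {ws : List A // ws.length = n + 1 ∧ P ws}
      = ∑ a : A, Nat.card {ws : List A // ws.length = n ∧ P (a :: ws)} := by
  have := fun a : A => finite_words n fun ws => P (a :: ws)
  rw [← Nat.card_sigma]
  refine Nat.card_congr (Equiv.symm (Equiv.ofBijective
    (fun x => ⟨x.1 :: x.2.1, by simp [x.2.2.1], x.2.2.2⟩) ⟨?_, ?_⟩))
  · rintro ⟨a, ws, h⟩ ⟨b, ws', h'⟩ heq
    simp only [Subtype.mk.injEq, List.cons.injEq] at heq
    obtain ⟨rfl, rfl⟩ := heq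
    rfl
  · rintro ⟨ws, h⟩
    cases ws with
    | nil => simp at h
    | cons a ws => exact ⟨⟨a, ws, by simpa using h.1, h.2⟩, rfl⟩

section
variable {L : Type*} [Fintype L] [DecidableEq L]

lemma wordCount_zero (t : L) (bs : List Bool) (p : Option L) :
    wordCount t bs p 0 = if bs = [] ∧ p = some t then 1 else 0 := by
  unfold wordCount
  split_ifs with h
  · rw [Nat.card_eq_one_iff_unique]
    refine ⟨⟨fun x y => Subtype.ext ?_⟩, ⟨⟨[], rfl, ?_⟩⟩⟩
    · rw [List.length_eq_zero_iff.mp x.2.1, List.length_eq_zero_iff.mp y.2.1]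
    · simpa [WordOk] using h
  · rw [Nat.card_eq_zero]
    left
    refine ⟨fun x => h ?_⟩
    obtain ⟨ws, h1, h2⟩ := x
    obtain rfl := List.length_eq_zero_iff.mp h1
    simpa [WordOk] using h2

lemma card_words_and {A : Type*} (n : ℕ) (c : Prop) [Decidable c] (P : List A → Prop) :
    Nat.card {ws : List A // ws.length = n ∧ c ∧ P ws}
      = if c then Nat.card {ws : List A // ws.length = n ∧ P ws} else 0 := by
  split_ifs with h <;> simp [h]

lemma wordCount_nil_succ (t : L) (p : Option L) (n : ℕ) :
    wordCount t [] p (n + 1) = ∑ a, if p = some a then 0 else wordCount t [] (some a) n := by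
  unfold wordCount
  rw [card_words_succ, Fintype.sum_option]
  simp only [WordOk, and_false, card_words_and, ite_not, ne_eq]
  simp

lemma wordCount_cons_succ (t : L) (b : Bool) (bs : List Bool) (p : Option L) (n : ℕ) :
    wordCount t (b :: bs) p (n + 1) = (if p = none → b = false then wordCount t bs none n else 0)
      + ∑ a, if p = some a then 0 else wordCount t (b :: bs) (some a) n := by
  unfold wordCount
  rw [card_words_succ, Fintype.sum_option]
  simp only [WordOk, card_words_and, ite_not, ne_eq]

open PowerSeries

/-- The generating function of admissible words by length. -/
noncomputable def wordSeries (t : L) (bs : List Bool) (p : Option L) : ℚ⟦X⟧ :=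
  PowerSeries.mk fun n => (wordCount t bs p n : ℚ)

lemma wordSeries_nil (t : L) (p : Option L) :
    wordSeries t [] p = (if p = some t then 1 else 0)
      + X * ∑ a, if p = some a then 0 else wordSeries t [] (some a) := by
  ext n
  cases n with
  | zero => simp [wordSeries, wordCount_zero]
  | succ n =>
    rw [wordSeries, coeff_mk, wordCount_nil_succ, map_add, coeff_succ_X_mul, map_sum]
    push_cast
    rw [show (coeff (n + 1)) (if p = some t then (1 : ℚ⟦X⟧) else 0) = 0 by
      split_ifs <;> simp [coeff_one], zero_add]
    refine Finset.sum_congr rfl fun a _ => ?_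
    split_ifs <;> simp [wordSeries]

lemma wordSeries_cons (t : L) (b : Bool) (bs : List Bool) (p : Option L) :
    wordSeries t (b :: bs) p = X * (if p = none → b = false then wordSeries t bs none else 0)
      + X * ∑ a, if p = some a then 0 else wordSeries t (b :: bs) (some a) := by
  ext n
  cases n with
  | zero =>
    rw [← mul_add, coeff_zero_X_mul, wordSeries, coeff_mk, wordCount_zero]
    simp
  | succ n =>
    rw [wordSeries, coeff_mk, wordCount_cons_succ, map_add, coeff_succ_X_mul, coeff_succ_X_mul,
      map_sum]
    push_cast
    congr 1
    · split_ifs <;> simp [wordSeries]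
    · refine Finset.sum_congr rfl fun a _ => ?_
      split_ifs <;> simp [wordSeries]

lemma sum_ite_some_eq (c : L) (f : L → ℚ⟦X⟧) :
    (∑ a, if some c = some a then 0 else f a) = ∑ a, f a - f c := by
  rw [eq_sub_iff_add_eq, ← Finset.sum_add_sum_compl {c} f, Finset.sum_singleton, add_comm]
  congr 1
  rw [← Finset.sum_add_sum_compl {c}, Finset.sum_singleton]
  simp only [if_true, zero_add]
  refine Finset.sum_congr rfl fun a ha => if_neg ?_
  simp only [Finset.mem_compl, Finset.mem_singleton] at ha
  simpa using fun h => ha h.symm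

lemma one_add_X_ne_zero : (1 + X : ℚ⟦X⟧) ≠ 0 := fun h => by
  have := congrArg constantCoeff h
  simp at this

variable (L) in
/-- The denominator `1 - (l - 1) X`, where `l` is the number of labels. -/
noncomputable def wordDenom : ℚ⟦X⟧ := 1 - C ((Fintype.card L : ℚ) - 1) * X

lemma wordDenom_ne_zero : wordDenom L ≠ 0 := fun h => by
  have := congrArg constantCoeff h
  simp [wordDenom] at this

lemma wordDenom_eq : wordDenom L = 1 + X - (Fintype.card L : ℚ⟦X⟧) * X := by
  rw [wordDenom, map_sub, map_natCast, map_one]; ring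

/-- The equations for the individual labels involve each other only through their sum, so adding
them isolates that sum. -/
lemma sum_wordSeries_nil_mul (t : L) : (∑ a, wordSeries t [] (some a)) * wordDenom L = 1 := by
  have h : ∀ c : L, wordSeries t [] (some c) * (1 + X)
      = (if c = t then 1 else 0) + X * ∑ a, wordSeries t [] (some a) := fun c => by
    have := wordSeries_nil t (some c)
    rw [sum_ite_some_eq] at this
    simp only [Option.some.injEq] at this
    linear_combination this
  have h2 := Finset.sum_congr rfl fun c (_ : c ∈ Finset.univ) => h c
  rw [← Finset.sum_mul, Finset.sum_add_distrib, Finset.sum_const, Finset.card_univ,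
    nsmul_eq_mul] at h2
  simp only [Finset.sum_ite_eq', Finset.mem_univ, if_true] at h2
  rw [wordDenom_eq]
  linear_combination h2

lemma wordSeries_nil_none_mul (t : L) : wordSeries t [] none * wordDenom L = X := by
  rw [wordSeries_nil]
  simp only [reduceCtorEq, if_false, zero_add]
  rw [mul_assoc, sum_wordSeries_nil_mul, mul_one]

lemma wordSeries_nil_some_mul {t c : L} (h : c ≠ t) :
    wordSeries t [] (some c) * (wordDenom L * (1 + X)) = X := by
  have := wordSeries_nil t (some c)
  rw [sum_ite_some_eq, if_neg (by simpa using h)] at this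
  linear_combination wordDenom L * this + X * sum_wordSeries_nil_mul t

lemma wordSeries_cons_some_aux (t : L) (b : Bool) (bs : List Bool) (c : L) :
    wordSeries t (b :: bs) (some c) * (1 + X)
      = X * wordSeries t bs none + X * ∑ a, wordSeries t (b :: bs) (some a) := by
  have := wordSeries_cons t b bs (some c)
  rw [sum_ite_some_eq, if_pos (by simp)] at this
  linear_combination this

lemma sum_wordSeries_cons_mul (t : L) (b : Bool) (bs : List Bool) :
    (∑ a, wordSeries t (b :: bs) (some a)) * wordDenom L
      = (Fintype.card L : ℚ⟦X⟧) * X * wordSeries t bs none := by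
  have h2 := Finset.sum_congr rfl
    fun c (_ : c ∈ Finset.univ) => wordSeries_cons_some_aux t b bs c
  rw [← Finset.sum_mul, Finset.sum_const, Finset.card_univ, nsmul_eq_mul] at h2
  rw [wordDenom_eq]
  linear_combination h2

lemma wordSeries_cons_some_mul (t : L) (b : Bool) (bs : List Bool) (c : L) :
    wordSeries t (b :: bs) (some c) * wordDenom L = X * wordSeries t bs none := by
  apply mul_right_cancel₀ one_add_X_ne_zero
  linear_combination wordDenom L * wordSeries_cons_some_aux t b bs c
    + X * sum_wordSeries_cons_mul t b bs + X * wordSeries t bs none * wordDenom_eq (L := L)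

/-- Between two `none`s comes a run of labels, each different from the one before: `lX / wordDenom`
if it must be nonempty (a loop to break), and `1 + lX / wordDenom = (1 + X) / wordDenom` otherwise.
-/
lemma wordSeries_cons_none_mul (t : L) (b : Bool) (bs : List Bool) :
    wordSeries t (b :: bs) none * wordDenom L
      = X * (if b then (Fintype.card L : ℚ⟦X⟧) * X else 1 + X) * wordSeries t bs none := by
  rw [wordSeries_cons]
  simp only [reduceCtorEq, if_false, forall_const]
  cases b with
  | true =>
    simp only [Bool.true_eq_false, if_false, if_true]
    linear_combination X * sum_wordSeries_cons_mul t true bs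
  | false =>
    simp only [Bool.false_eq_true, if_false, if_true]
    linear_combination X * sum_wordSeries_cons_mul t false bs
      + X * wordSeries t bs none * wordDenom_eq (L := L)

lemma wordSeries_none_mul_pow (t : L) (bs : List Bool) :
    wordSeries t bs none * wordDenom L ^ (bs.length + 1) = X ^ (bs.length + 1)
      * ((Fintype.card L : ℚ⟦X⟧) * X) ^ bs.count true * (1 + X) ^ bs.count false := by
  induction bs with
  | nil => simp [wordSeries_nil_none_mul]
  | cons b bs ih =>
    rw [List.length_cons, pow_succ', ← mul_assoc, wordSeries_cons_none_mul, mul_assoc, ih]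
    cases b <;> simp <;> ring

lemma wordSeries_cons_some_mul_pow (t : L) (b : Bool) (bs : List Bool) (c : L) :
    wordSeries t (b :: bs) (some c) * wordDenom L ^ (bs.length + 2) = X ^ (bs.length + 2)
      * ((Fintype.card L : ℚ⟦X⟧) * X) ^ bs.count true * (1 + X) ^ bs.count false := by
  rw [pow_succ', ← mul_assoc, wordSeries_cons_some_mul, mul_assoc, wordSeries_none_mul_pow]
  ring

/-- The words that follow the first clique point, in terms of the inclusion–exclusion numbers. -/
lemma wordSeries_some_eq (t c : L) (bs : List Bool) (h : bs ≠ [] ∨ c ≠ t) (v e : ℤ)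
    (hV : v - e = bs.length) :
    wordSeries t bs (some c) = X ^ (bs.length + 1)
      * ((Fintype.card L : ℚ⟦X⟧) * X) ^ bs.tail.count true
      * pSeries (Fintype.card L) v e (bs.tail.count true) := by
  have hP : pSeries (Fintype.card L) v e (bs.tail.count true) * (1 + X) ^ 2
      * wordDenom L ^ (bs.length + 1) = (1 + X) ^ (bs.length + 1 - bs.tail.count true) := by
    rw [pSeries_mul]
    exact qSeries_mul _ _ _
      ((List.count_le_length.trans (by simp)).trans (Nat.le_succ _)) v e hV
  have hD : wordDenom L ^ (bs.length + 1) ≠ 0 := pow_ne_zero _ wordDenom_ne_zero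
  apply mul_right_cancel₀ (mul_ne_zero (pow_ne_zero 2 one_add_X_ne_zero) hD)
  cases bs with
  | nil =>
    simp only [List.tail_nil, List.count_nil, List.length_nil, zero_add, pow_one, pow_zero,
      mul_one, Nat.sub_zero] at hP ⊢
    -- If no `none` remains and `c = t`, the empty word is admissible and spoils the formula; `h`
    -- excludes this.
    linear_combination (1 + X) * wordSeries_nil_some_mul (h.resolve_left (by simp)) - X * hP
  | cons b bs =>
    simp only [List.tail_cons, List.length_cons] at hP ⊢
    have hlen : bs.length + 1 + 1 - bs.count true = bs.count false + 2 := by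
      have h3 := List.count_true_add_count_false bs
      omega
    rw [hlen] at hP
    linear_combination (1 + X) ^ 2 * wordSeries_cons_some_mul_pow t b bs c
      - X ^ (bs.length + 2) * ((Fintype.card L : ℚ⟦X⟧) * X) ^ bs.count true * hP

/-- The first of the `v` points is the letter `c`, so the coefficient of `X^(v-1)` is wanted.
Removing `X^(V+1+k)`, with `V` the length of `bs`, leaves the exponent `e - 2 - k`. The first flag
is irrelevant after a label. -/
lemma wordCount_some_eq (t c : L) (bs : List Bool) (h : bs ≠ [] ∨ c ≠ t) (v e : ℕ) (he : 1 ≤ e)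
    (hV : v = bs.length + e) :
    (wordCount t bs (some c) (v - 1) : ℚ) = if bs.tail.count true + 2 ≤ e then
      (Fintype.card L : ℚ) ^ bs.tail.count true / ((e - 2 - bs.tail.count true).factorial : ℚ)
        * pNum (Fintype.card L) v e (bs.tail.count true) (e - 2 - bs.tail.count true) else 0 := by
  have key := congrArg (coeff (v - 1)) (wordSeries_some_eq t c bs h v e (by rw [hV]; push_cast; ring))
  rw [wordSeries, coeff_mk] at key
  rw [key]
  generalize bs.tail.count true = k
  rw [show X ^ (bs.length + 1) * ((Fintype.card L : ℚ⟦X⟧) * X) ^ k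
      * pSeries (Fintype.card L) v e k
      = X ^ (bs.length + 1 + k) * (C ((Fintype.card L : ℚ) ^ k)
        * pSeries (Fintype.card L) v e k) by simp only [map_pow, map_natCast]; ring,
    coeff_X_pow_mul', coeff_C_mul]
  subst hV
  by_cases hk : k + 2 ≤ e
  · rw [if_pos (by omega), if_pos hk, pSeries, coeff_mk,
      show bs.length + e - 1 - (bs.length + 1 + k) = e - 2 - k by omega]
    ring
  · rw [if_neg (by omega), if_neg hk]
end

/-! ### Rotations and orbit counting -/

lemma ChordDiagram.smul_rel {N d : ℕ} (g : Equiv.Perm (Fin N)) (D : ChordDiagram N d)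
    (x y : Fin N) : (g • D).rel x y ↔ D.rel (g⁻¹ x) (g⁻¹ y) := Iff.rfl

instance ChordDiagram.instFinite (N d : ℕ) : Finite (ChordDiagram N d) :=
  Finite.of_injective (fun D => fun x y => D.rel x y) fun D E h => by
    apply ChordDiagram.ext
    exact Setoid.ext fun x y => iff_of_eq (congrFun (congrFun h x) y)

lemma orderOf_finRotate (N : ℕ) (hN : 1 ≤ N) : orderOf (finRotate N) = N := by
  obtain _ | _ | N := N
  · omega
  · simp [Subsingleton.elim (finRotate 1) 1]
  · rw [(isCycle_finRotate (n := N)).orderOf, support_finRotate]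
    simp

/-- If `g = r ^ i` has order `m`, then `gcd(N, i) = N / m`, so one subgroup contains the other and
their orders agree. -/
lemma zpowers_eq_of_orderOf {G : Type*} [Group G] {r g : G} {N m : ℕ} (hN : 1 ≤ N)
    (hr : orderOf r = N) (hg : g ∈ Subgroup.zpowers r) (hm : orderOf g = m) (hmN : m ∣ N) :
    Subgroup.zpowers g = Subgroup.zpowers (r ^ (N / m)) := by
  have hfin : IsOfFinOrder r := orderOf_pos_iff.mp (by omega)
  obtain ⟨i, rfl⟩ := hfin.mem_powers_iff_mem_zpowers.mpr hg
  have h1 : orderOf (r ^ i) = N / N.gcd i := by rw [hfin.orderOf_pow, hr]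
  obtain ⟨c, rfl⟩ := hmN
  have hm0 : 0 < m := Nat.pos_of_mul_pos_right (by omega : 0 < m * c)
  have hc0 : 0 < c := Nat.pos_of_mul_pos_left (by omega : 0 < m * c)
  rw [Nat.mul_div_cancel_left c hm0]
  have h2 : (m * c).gcd i = c := by
    have h3 := Nat.div_mul_cancel (Nat.gcd_dvd_left (m * c) i)
    rw [← h1, hm] at h3
    exact Nat.eq_of_mul_eq_mul_left hm0 h3
  have hle : Subgroup.zpowers (r ^ i) ≤ Subgroup.zpowers (r ^ c) := by
    rw [Subgroup.zpowers_le]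
    obtain ⟨j, hj⟩ : c ∣ i := h2 ▸ Nat.gcd_dvd_right (m * c) i
    rw [hj, pow_mul]
    exact Subgroup.pow_mem _ (Subgroup.mem_zpowers _) _
  have hcard : Nat.card (Subgroup.zpowers (r ^ c)) = m := by
    rw [Nat.card_zpowers, hfin.orderOf_pow, hr, Nat.gcd_eq_right (Dvd.intro_left m rfl),
      Nat.mul_div_cancel _ hc0]
  have : Finite (Subgroup.zpowers (r ^ c)) := Nat.finite_of_card_ne_zero (by omega)
  exact Subgroup.eq_of_le_of_card_ge hle (by rw [hcard, Nat.card_zpowers, hm])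

lemma smul_eq_iff_of_zpowers_eq {G X : Type*} [Group G] [MulAction G X] {g h : G}
    (hgh : Subgroup.zpowers g = Subgroup.zpowers h) (x : X) : g • x = x ↔ h • x = x := by
  rw [← MulAction.mem_stabilizer_iff, ← MulAction.mem_stabilizer_iff, ← Subgroup.zpowers_le, hgh,
    Subgroup.zpowers_le]

lemma card_fixed_loopless {N d m : ℕ} (hN : 1 ≤ N) (hm : m ∣ N) {g : Equiv.Perm (Fin N)}
    (hg : g ∈ rotationGroup N) (hgm : orderOf g = m) :
    Nat.card {D : ChordDiagram N d // D.IsLoopless ∧ g • D = D} = numSymmetricLoopless d N m := by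
  have h := zpowers_eq_of_orderOf hN (orderOf_finRotate N hN) hg hgm hm
  refine Nat.card_congr (Equiv.subtypeEquivRight fun D => ?_)
  rw [smul_eq_iff_of_zpowers_eq h D]
  rfl

lemma commute_finRotate {N : ℕ} {g : Equiv.Perm (Fin N)} (hg : g ∈ rotationGroup N) (x : Fin N) :
    g (finRotate N x) = finRotate N (g x) := by
  obtain ⟨i, rfl⟩ := hg
  have := (Commute.refl (finRotate N)).zpow_left i
  exact congrArg (fun p : Equiv.Perm (Fin N) => p x) this

lemma ChordDiagram.IsLoopless.smul {N d : ℕ} {g : Equiv.Perm (Fin N)} (hg : g ∈ rotationGroup N)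
    {D : ChordDiagram N d} (hD : D.IsLoopless) : (g • D).IsLoopless := fun x hx h => by
  rw [ChordDiagram.smul_rel, commute_finRotate (inv_mem hg)] at h
  refine hD _ (fun h2 => hx ?_) h
  rw [← commute_finRotate (inv_mem hg)] at h2
  exact (g⁻¹ : Equiv.Perm (Fin N)).injective h2

/-- The loopless diagrams, as a set with an action of the rotations. -/
def looplessSub (N d : ℕ) : SubMulAction (rotationGroup N) (ChordDiagram N d) where
  carrier := {D | D.IsLoopless}
  smul_mem' g _ h := ChordDiagram.IsLoopless.smul g.2 h

/-- Burnside's lemma; there are `φ(m)` rotations of order `m`, all with the same number of fixed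
diagrams. -/
lemma card_looplessSub_quotient_mul (N d : ℕ) (hN : 1 ≤ N) :
    ∑ m ∈ N.divisors, Nat.totient m * numSymmetricLoopless d N m
      = Nat.card (Quotient (MulAction.orbitRel (rotationGroup N) (looplessSub N d))) * N := by
  classical
  have hord := orderOf_finRotate N hN
  have : Fintype (looplessSub N d) := Fintype.ofFinite _
  have : Fintype (Quotient (MulAction.orbitRel (rotationGroup N) (looplessSub N d))) :=
    Fintype.ofFinite _
  have hcardG : Fintype.card (rotationGroup N) = N := by
    rw [← Nat.card_eq_fintype_card, rotationGroup, Nat.card_zpowers, hord]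
  have hcyc : IsCyclic (rotationGroup N) := by unfold rotationGroup; infer_instance
  have hB := MulAction.sum_card_fixedBy_eq_card_orbits_mul_card_group (rotationGroup N)
    (looplessSub N d)
  have hdvd : ∀ g : rotationGroup N, orderOf g ∣ N := fun g => by
    conv_rhs => rw [← hcardG]
    exact orderOf_dvd_card
  have hfix : ∀ g : rotationGroup N, Fintype.card (MulAction.fixedBy (looplessSub N d) g)
      = numSymmetricLoopless d N (orderOf g) := fun g => by
    rw [← card_fixed_loopless hN (hdvd g) g.2 (Subgroup.orderOf_coe g), ← Nat.card_eq_fintype_card]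
    refine Nat.card_congr ((Equiv.subtypeEquivRight fun D => ?_).trans
      (Equiv.subtypeSubtypeEquivSubtypeInter (fun D : ChordDiagram N d => D.IsLoopless)
        fun D => (g : Equiv.Perm (Fin N)) • D = D))
    exact Subtype.ext_iff
  rw [Finset.sum_congr rfl fun g _ => hfix g, hcardG,
    ← Finset.sum_fiberwise_of_maps_to (g := fun g : rotationGroup N => orderOf g)
      (t := N.divisors)
      (fun g _ => Nat.mem_divisors.mpr ⟨hdvd g, by omega⟩)] at hB
  rw [Nat.card_eq_fintype_card, ← hB]
  refine Finset.sum_congr rfl fun m hm => ?_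
  rw [Finset.sum_congr rfl fun g hg => by rw [(Finset.mem_filter.mp hg).2], Finset.sum_const,
    smul_eq_mul]
  congr 1
  refine (IsCyclic.card_orderOf_eq_totient ?_).symm
  rw [hcardG]
  exact Nat.dvd_of_mem_divisors hm

lemma numUpToRotation_eq (n d : ℕ) (hn : 1 ≤ n) (hd : 1 ≤ d) :
    (numUpToRotation n d : ℚ) = 1 / ((d : ℚ) * n) * ∑ m ∈ (d * n).divisors,
      (Nat.totient m : ℚ) * (numSymmetricLoopless d (d * n) m : ℚ) := by
  have hB := congrArg (Nat.cast (R := ℚ))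
    (card_looplessSub_quotient_mul (d * n) d (Nat.mul_pos hd hn))
  have hQ : numUpToRotation n d = Nat.card
      (Quotient (MulAction.orbitRel (rotationGroup (d * n)) (looplessSub (d * n) d))) := by
    rw [SubMulAction.orbitRel_of_subMul]
    rfl
  push_cast at hB
  rw [hQ, hB]
  have : (d : ℚ) ≠ 0 := by positivity
  have : (n : ℚ) ≠ 0 := by positivity
  field_simp

/-! ### Symmetric diagrams on sectors and positions -/

/-- Diagrams on the points `G × X` invariant under translation of the first coordinate. For
`G = ZMod m` and `X = Fin v` they are the `m`-symmetric chord diagrams on `m * v` points. -/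
@[ext]
structure SymDiagram (G X : Type*) [AddCommGroup G] (d : ℕ) where
  rel : Setoid (G × X)
  shift : ∀ (g s t : G) (x y : X), rel (s, x) (t, y) → rel (g + s, x) (g + t, y)
  card_chord : ∀ p : G × X, {q : G × X | rel p q}.ncard = d

namespace SymDiagram

instance instFinite (G X : Type*) [AddCommGroup G] [Finite G] [Finite X] (d : ℕ) :
    Finite (SymDiagram G X d) :=
  Finite.of_injective (fun D => fun x y => D.rel x y) fun D E h => by
    apply SymDiagram.ext
    exact Setoid.ext fun x y => iff_of_eq (congrFun (congrFun h x) y)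

variable {G X : Type*} [AddCommGroup G] {d : ℕ}

lemma rel_iff_shift (R : SymDiagram G X d) (g s t : G) (x y : X) :
    R.rel (s, x) (t, y) ↔ R.rel (g + s, x) (g + t, y) :=
  ⟨R.shift g s t x y, fun h => by simpa using R.shift (-g) _ _ x y h⟩

/-- The points `i` and `i + 1` of a sector lie on the same chord. -/
def IsLoop {v : ℕ} (R : SymDiagram G (Fin v) d) (i : ℕ) : Prop :=
  ∃ h : i + 1 < v, R.rel (0, ⟨i, by omega⟩) (0, ⟨i + 1, h⟩)

/-- The number of loops in each sector. -/
noncomputable def loops {v : ℕ} (R : SymDiagram G (Fin v) d) : ℕ := {i | R.IsLoop i}.ncard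

lemma finite_isLoop {v : ℕ} (R : SymDiagram G (Fin v) d) : {i | R.IsLoop i}.Finite :=
  (Set.finite_lt_nat v).subset fun i ⟨h, _⟩ => show i < v by omega

lemma loops_eq_zero_iff {v : ℕ} (R : SymDiagram G (Fin v) d) :
    R.loops = 0 ↔ ∀ i, ¬ R.IsLoop i := by
  rw [loops, Set.ncard_eq_zero R.finite_isLoop, Set.eq_empty_iff_forall_notMem]
  rfl

end SymDiagram

section
variable {m v : ℕ} [NeZero m]

/-- The point at position `x` of sector `s`. -/
def sectorPoint (p : ZMod m × Fin v) : Fin (m * v) :=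
  ⟨p.1.val * v + p.2, by
    have h1 := ZMod.val_lt p.1
    have h2 := p.2.2
    calc p.1.val * v + p.2 < (p.1.val + 1) * v := by rw [add_mul]; omega
      _ ≤ m * v := Nat.mul_le_mul_right _ h1⟩

lemma sectorPoint_injective : Function.Injective (sectorPoint (m := m) (v := v)) := by
  rintro ⟨s, x⟩ ⟨t, y⟩ h
  have h' : s.val * v + x = t.val * v + y := congrArg Fin.val h
  have hv : 0 < v := by have := x.2; omega
  have h1 : s.val = t.val := by
    have := congrArg (· / v) h'
    simpa [Nat.add_div_of_dvd_right (Dvd.intro_left _ rfl), hv, Nat.mul_div_cancel _ hv,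
      Nat.div_eq_of_lt] using this
  have h2 : x = y := Fin.ext (by rw [h1] at h'; omega)
  exact Prod.ext (ZMod.val_injective m h1) h2

/-- The points of the circle, as pairs of a sector and a position. -/
noncomputable def sectorEquiv (m v : ℕ) [NeZero m] : ZMod m × Fin v ≃ Fin (m * v) :=
  Equiv.ofBijective sectorPoint ((Fintype.bijective_iff_injective_and_card _).mpr
    ⟨sectorPoint_injective, by simp [ZMod.card]⟩)

lemma sectorEquiv_val (s : ZMod m) (x : Fin v) :
    (sectorEquiv m v (s, x) : ℕ) = s.val * v + x := rfl

lemma finRotate_val {N : ℕ} (x : Fin N) : (finRotate N x : ℕ) = (x + 1) % N := by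
  obtain _ | N := N
  · exact x.elim0
  · rw [finRotate_apply, Fin.val_add, Fin.val_one', Nat.add_mod_mod]

lemma finRotate_pow_val (N k : ℕ) (x : Fin N) :
    ((finRotate N ^ k) x : ℕ) = (x + k) % N := by
  induction k with
  | zero => simp [Nat.mod_eq_of_lt x.2]
  | succ k ih =>
    rw [pow_succ', Equiv.Perm.mul_apply, finRotate_val, ih, Nat.mod_add_mod, add_assoc]

lemma sectorEquiv_add_one (s : ZMod m) (x : Fin v) :
    sectorEquiv m v (s + 1, x) = (finRotate (m * v) ^ v) (sectorEquiv m v (s, x)) := by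
  apply Fin.ext
  rw [finRotate_pow_val, sectorEquiv_val, sectorEquiv_val]
  have hs := ZMod.val_lt s
  have hx := x.2
  rw [ZMod.val_add, ZMod.val_one_eq_one_mod, Nat.add_mod_mod]
  rcases Nat.lt_or_ge (s.val + 1) m with h | h
  · rw [Nat.mod_eq_of_lt h, Nat.mod_eq_of_lt]
    · ring
    · calc s.val * v + x + v < (s.val + 2) * v := by rw [add_mul]; omega
        _ ≤ m * v := Nat.mul_le_mul_right _ (by omega)
  · have h' : s.val + 1 = m := by omega
    have : s.val * v + x + v = x + m * v := by
      calc s.val * v + x + v = x + (s.val + 1) * v := by ring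
        _ = _ := by rw [h']
    rw [this, h', Nat.mod_self, Nat.add_mod_right, Nat.mod_eq_of_lt]
    · simp
    · exact lt_of_lt_of_le hx (Nat.le_mul_of_pos_left _ (by omega))

lemma finRotate_sectorEquiv_of_lt (s : ZMod m) (i : ℕ) (h : i + 1 < v) :
    finRotate (m * v) (sectorEquiv m v (s, ⟨i, by omega⟩)) = sectorEquiv m v (s, ⟨i + 1, h⟩) := by
  apply Fin.ext
  have := (sectorEquiv m v (s, ⟨i + 1, h⟩)).2
  rw [sectorEquiv_val] at this
  rw [finRotate_val, sectorEquiv_val, sectorEquiv_val, Nat.mod_eq_of_lt (by exact this)]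
  rfl

lemma finRotate_sectorEquiv_last (s : ZMod m) (h : 0 < v) :
    finRotate (m * v) (sectorEquiv m v (s, ⟨v - 1, by omega⟩))
      = sectorEquiv m v (s + 1, ⟨0, h⟩) := by
  apply Fin.ext
  rw [sectorEquiv_add_one, finRotate_pow_val, finRotate_val, sectorEquiv_val, sectorEquiv_val]
  congr 1
  simp only [add_zero]
  omega

lemma isSymmetric_iff {d : ℕ} (D : ChordDiagram (m * v) d) :
    D.IsSymmetric m ↔ ∀ (s t : ZMod m) (x y : Fin v),
      D.rel (sectorEquiv m v (s, x)) (sectorEquiv m v (t, y)) ↔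
        D.rel (sectorEquiv m v (s + 1, x)) (sectorEquiv m v (t + 1, y)) := by
  rw [ChordDiagram.IsSymmetric, Nat.mul_div_cancel_left _ (NeZero.pos m)]
  constructor
  · intro h s t x y
    conv_rhs => rw [← h]
    rw [ChordDiagram.smul_rel, sectorEquiv_add_one, sectorEquiv_add_one, Equiv.Perm.inv_def,
      Equiv.symm_apply_apply, Equiv.symm_apply_apply]
  · intro h
    refine ChordDiagram.ext (Setoid.ext fun a b => ?_)
    change D.rel _ _ ↔ _
    obtain ⟨⟨s, x⟩, hs⟩ := (sectorEquiv m v).surjective ((finRotate (m * v) ^ v)⁻¹ a)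
    obtain ⟨⟨t, y⟩, ht⟩ := (sectorEquiv m v).surjective ((finRotate (m * v) ^ v)⁻¹ b)
    rw [← hs, ← ht, h, sectorEquiv_add_one, sectorEquiv_add_one, hs, ht,
      Equiv.Perm.inv_def, Equiv.apply_symm_apply, Equiv.apply_symm_apply]

/-- Symmetric chord diagrams as diagrams on sectors and positions. -/
noncomputable def symDiagramEquiv (m v d : ℕ) [NeZero m] :
    {D : ChordDiagram (m * v) d // D.IsSymmetric m} ≃ SymDiagram (ZMod m) (Fin v) d where
  toFun D :=
    { rel := D.1.rel.comap (sectorEquiv m v)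
      shift := fun g s t x y h => by
        -- Symmetry gives translation by `1`; every `g` is a natural multiple of it.
        have hg : ((g.val : ℕ) : ZMod m) = g := ZMod.natCast_zmod_val g
        rw [← hg]
        generalize g.val = n
        induction n with
        | zero => simpa using h
        | succ n ih =>
          rw [Nat.cast_succ, add_right_comm, add_right_comm _ _ t]
          exact ((isSymmetric_iff D.1).mp D.2 _ _ _ _).mp ih
      card_chord := fun p => by
        refine Eq.trans ?_ (D.1.card_chord (sectorEquiv m v p))
        exact Set.ncard_preimage_of_injective_subset_range
          (s := {y | D.1.rel (sectorEquiv m v p) y}) (sectorEquiv m v).injective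
          (by rw [(sectorEquiv m v).surjective.range_eq]; exact Set.subset_univ _) }
  invFun R :=
    ⟨{ rel := R.rel.comap (sectorEquiv m v).symm
       card_chord := fun p => by
        refine Eq.trans ?_ (R.card_chord ((sectorEquiv m v).symm p))
        exact Set.ncard_preimage_of_injective_subset_range
          (s := {y | R.rel ((sectorEquiv m v).symm p) y}) (sectorEquiv m v).symm.injective
          (by rw [(sectorEquiv m v).symm.surjective.range_eq]; exact Set.subset_univ _) }, by
      rw [isSymmetric_iff]
      intro s t x y
      change R.rel _ _ ↔ R.rel _ _
      simp only [Equiv.symm_apply_apply]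
      rw [R.rel_iff_shift 1, add_comm 1, add_comm 1]⟩
  left_inv D := by
    refine Subtype.ext (ChordDiagram.ext (Setoid.ext fun a b => ?_))
    change D.1.rel _ _ ↔ _
    simp
  right_inv R := by
    refine SymDiagram.ext (Setoid.ext fun a b => ?_)
    change R.rel _ _ ↔ _
    simp

lemma symDiagramEquiv_isLoop {d : ℕ} (D : {D : ChordDiagram (m * v) d // D.IsSymmetric m})
    (s : ZMod m) (i : ℕ) : (symDiagramEquiv m v d D).IsLoop i ↔ ∃ h : i + 1 < v,
      D.1.rel (sectorEquiv m v (s, ⟨i, by omega⟩)) (sectorEquiv m v (s, ⟨i + 1, h⟩)) := by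
  refine exists_congr fun h => ?_
  rw [SymDiagram.rel_iff_shift _ s, add_zero]
  rfl

lemma sectorLoops_eq_loops {d : ℕ} (D : {D : ChordDiagram (m * v) d // D.IsSymmetric m})
    (s : ℕ) (hs : s < m) : D.1.sectorLoops v s = (symDiagramEquiv m v d D).loops := by
  rw [ChordDiagram.sectorLoops, SymDiagram.loops]
  congr 1
  ext i
  have hval : ((s : ZMod m)).val = s := ZMod.val_natCast_of_lt hs
  simp only [Set.mem_ofPred_eq]
  rw [symDiagramEquiv_isLoop D (s : ZMod m) i]
  constructor
  · rintro ⟨h, x, y, hx, hy, hxy⟩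
    refine ⟨h, ?_⟩
    convert hxy <;> apply Fin.ext <;> rw [sectorEquiv_val, hval]
    · exact hx.symm
    · exact hy.symm
  · rintro ⟨h, hxy⟩
    exact ⟨h, _, _, by rw [sectorEquiv_val, hval], by rw [sectorEquiv_val, hval]; rfl, hxy⟩

lemma numLinear_eq (m v d k : ℕ) [NeZero m] :
    numLinear m d v k = Nat.card {R : SymDiagram (ZMod m) (Fin v) d // R.loops = k} := by
  rw [numLinear, if_pos (by positivity)]
  change Nat.card {D : ChordDiagram (m * v) d // D.IsSymmetric m ∧
    ∀ s < m, D.sectorLoops v s = k} = _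
  refine Nat.card_congr ((Equiv.subtypeSubtypeEquivSubtypeInter
    (fun D : ChordDiagram (m * v) d => D.IsSymmetric m) _).symm.trans
      ((symDiagramEquiv m v d).subtypeEquiv fun D => ?_))
  constructor
  · intro h
    rw [← sectorLoops_eq_loops D 0 (NeZero.pos m)]
    exact h 0 (NeZero.pos m)
  · intro h s hs
    rw [sectorLoops_eq_loops D s hs, h]

/-- Neighbouring points lie in one sector or straddle a sector boundary, and translation moves
either pair to sector `0`. On a one-point circle `IsLoopless` is vacuous while the boundary relation
is reflexive, whence `hN`. -/
lemma isLoopless_iff {d : ℕ} (hv : 0 < v) (hN : 2 ≤ m * v)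
    (D : {D : ChordDiagram (m * v) d // D.IsSymmetric m}) : D.1.IsLoopless ↔
      (symDiagramEquiv m v d D).loops = 0 ∧
        ¬ (symDiagramEquiv m v d D).rel (0, ⟨v - 1, by omega⟩) (1, ⟨0, hv⟩) := by
  rw [SymDiagram.loops_eq_zero_iff]
  have hne : ∀ x : Fin (m * v), finRotate (m * v) x ≠ x := fun x h => by
    have h2 := congrArg Fin.val h
    rw [finRotate_val] at h2
    rcases Nat.lt_or_ge (x + 1 : ℕ) (m * v) with h3 | h3
    · rw [Nat.mod_eq_of_lt h3] at h2; omega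
    · have : (x + 1 : ℕ) = m * v := by omega
      rw [this, Nat.mod_self] at h2
      omega
  constructor
  · intro h
    refine ⟨fun i hi => ?_, fun hb => ?_⟩
    · obtain ⟨hi, hr⟩ := hi
      refine h (sectorEquiv m v (0, ⟨i, by omega⟩)) (hne _) ?_
      rw [finRotate_sectorEquiv_of_lt _ _ hi]
      exact hr
    · refine h (sectorEquiv m v (0, ⟨v - 1, by omega⟩)) (hne _) ?_
      rw [finRotate_sectorEquiv_last _ hv, zero_add]
      exact hb
  · rintro ⟨h1, h2⟩ a - ha
    obtain ⟨⟨s, i, hi⟩, rfl⟩ := (sectorEquiv m v).surjective a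
    rcases Nat.lt_or_ge (i + 1) v with h | h
    · rw [finRotate_sectorEquiv_of_lt s i h] at ha
      exact h1 i ((symDiagramEquiv_isLoop D s i).mpr ⟨h, ha⟩)
    · obtain rfl : i = v - 1 := by omega
      rw [finRotate_sectorEquiv_last s hv] at ha
      refine h2 ?_
      rw [SymDiagram.rel_iff_shift _ s, add_zero]
      exact ha

/-- Loopless symmetric diagrams are the diagrams without loops in the sectors, except those with
loops between neighbouring sectors. -/
lemma numSymmetricLoopless_add (m v d : ℕ) [NeZero m] (hv : 0 < v) (hN : 2 ≤ m * v) :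
    numSymmetricLoopless d (m * v) m + Nat.card {R : SymDiagram (ZMod m) (Fin v) d //
      R.loops = 0 ∧ R.rel (0, ⟨v - 1, by omega⟩) (1, ⟨0, hv⟩)} = numLinear m d v 0 := by
  have h1 : numSymmetricLoopless d (m * v) m = Nat.card {R : SymDiagram (ZMod m) (Fin v) d //
      R.loops = 0 ∧ ¬ R.rel (0, ⟨v - 1, by omega⟩) (1, ⟨0, hv⟩)} := by
    rw [numSymmetricLoopless]
    refine Nat.card_congr (((Equiv.subtypeEquivRight fun D => and_comm).trans
      (Equiv.subtypeSubtypeEquivSubtypeInter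
        (fun D : ChordDiagram (m * v) d => D.IsSymmetric m) fun D => D.IsLoopless).symm).trans
      ((symDiagramEquiv m v d).subtypeEquiv fun D => isLoopless_iff hv hN D))
  rw [h1, numLinear_eq, add_comm]
  set B : SymDiagram (ZMod m) (Fin v) d → Prop :=
    fun R => R.rel (0, ⟨v - 1, by omega⟩) (1, ⟨0, hv⟩)
  classical
  rw [← Nat.card_congr (Equiv.sumCompl fun R : {R : SymDiagram (ZMod m) (Fin v) d //
    R.loops = 0} => B R.1), Nat.card_sum]
  congr 1
  · exact Nat.card_congr (Equiv.subtypeSubtypeEquivSubtypeInter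
      (fun R : SymDiagram (ZMod m) (Fin v) d => R.loops = 0) B).symm
  · exact Nat.card_congr (Equiv.subtypeSubtypeEquivSubtypeInter
      (fun R : SymDiagram (ZMod m) (Fin v) d => R.loops = 0) fun R => ¬ B R).symm
end

/-! ### Admissibility of words, position by position -/

/-- Each `none` after position `0` consumes one flag, so the flag for a `none` at `i + 1` has as
index the number of `none`s at positions `1, …, i`. -/
lemma wordOk_ofFn_iff {L : Type*} [DecidableEq L] (t : L) (bs : List Bool) (n : ℕ)
    (w : ℕ → Option L) : WordOk t bs (w 0) (List.ofFn fun i : Fin n => w (i + 1)) ↔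
      w n = some t ∧ bs.length = Nat.count (fun k => w (k + 1) = none) n ∧
      ∀ i < n, (w (i + 1) = none → w i = none →
          bs[Nat.count (fun k => w (k + 1) = none) i]? = some false)
        ∧ ∀ a, w i = some a → w (i + 1) ≠ some a := by
  induction n generalizing bs w with
  | zero => simp [WordOk, and_comm]
  | succ n ih =>
    have hforall : ∀ P : ℕ → Prop, (∀ i < n + 1, P i) ↔ P 0 ∧ ∀ i < n, P (i + 1) := fun P =>
      Nat.forall_lt_succ_left
    rw [List.ofFn_succ, hforall]
    simp only [Nat.count_succ', Nat.count_zero, Fin.val_zero, zero_add, Fin.val_succ]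
    have ih' := fun bs => ih bs (fun k => w (k + 1))
    simp only [zero_add] at ih'
    cases h1 : w 1 with
    | none =>
      rw [h1] at ih'
      cases bs with
      | nil => simp [WordOk]
      | cons b bs =>
        simp only [WordOk, ih' bs]
        simp
        tauto
    | some a =>
      rw [h1] at ih'
      have hW : WordOk t bs (w 0) (some a :: List.ofFn fun i : Fin n => w (i + 1 + 1)) ↔
          w 0 ≠ some a ∧ WordOk t bs (some a) (List.ofFn fun i : Fin n => w (i + 1 + 1)) := by
        cases bs <;> simp [WordOk]
      rw [hW, ih' bs]
      simp
      constructor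
      · rintro ⟨h, h2, h3, h4⟩
        refine ⟨h2, h3, ?_, h4⟩
        rintro b hb rfl
        exact h hb
      · rintro ⟨h2, h3, h, h4⟩
        exact ⟨fun hb => h a hb rfl, h2, h3, h4⟩

lemma card_fun_cons_eq {A : Type*} (n : ℕ) (a : A) (P : List A → Prop) :
    Nat.card {w : Fin (n + 1) → A // w 0 = a ∧ P (List.ofFn fun i : Fin n => w i.succ)}
      = Nat.card {ws : List A // ws.length = n ∧ P ws} := by
  refine Nat.card_congr (Equiv.ofBijective
    (fun w => ⟨List.ofFn fun i : Fin n => w.1 i.succ, by simp, w.2.2⟩) ⟨?_, ?_⟩)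
  · rintro ⟨w, h1, h2⟩ ⟨w', h1', h2'⟩ heq
    have := List.ofFn_injective (Subtype.ext_iff.mp heq)
    refine Subtype.ext (funext fun i => ?_)
    refine Fin.cases (h1.trans h1'.symm) (fun i => congrFun this i) i
  · rintro ⟨ws, rfl, h⟩
    exact ⟨⟨Fin.cons a ws.get, by simp, by simpa using h⟩, by simp⟩

/-! ### Removing and inserting the orbit of a chord -/

namespace SymDiagram
variable {G X Y : Type*} [AddCommGroup G] {d : ℕ}

/-- `w` describes the orbit of the chord through `(0, x₀)`: it assigns to a point of a sector its
label, or `none` if the point is off this orbit. -/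
def Fits (x₀ : X) (H : AddSubgroup G) (w : X → Option (G ⧸ H)) (R : SymDiagram G X d) : Prop :=
  ∀ t y, R.rel (0, x₀) (t, y) ↔ w y = some (t : G ⧸ H)

lemma Fits.apply_base {x₀ : X} {H : AddSubgroup G} {w : X → Option (G ⧸ H)}
    {R : SymDiagram G X d} (h : Fits x₀ H w R) : w x₀ = some 0 :=
  (h 0 x₀).mp (R.rel.refl _)

/-- `H` is the stabiliser of the chord through `(0, x₀)`. At each position this chord meets `G` in
nothing or in one coset of `H`, which is the label. -/
lemma exists_fits (x₀ : X) (R : SymDiagram G X d) :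
    ∃ p : (H : AddSubgroup G) × (X → Option (G ⧸ H)), Fits x₀ p.1 p.2 R := by
  classical
  let H : AddSubgroup G :=
    { carrier := {t | R.rel (0, x₀) (t, x₀)}
      zero_mem' := R.rel.refl _
      add_mem' := fun {a b} ha hb => R.rel.trans ha (by simpa using R.shift a _ _ _ _ hb)
      neg_mem' := fun {a} ha => by
        have := R.shift (-a) _ _ _ _ ha
        exact R.rel.symm (by simpa using this) }
  have key : ∀ s t y, R.rel (0, x₀) (s, y) → (R.rel (0, x₀) (t, y) ↔ (s : G ⧸ H) = t) := by
    intro s t y hs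
    rw [QuotientAddGroup.eq]
    change _ ↔ R.rel (0, x₀) (-s + t, x₀)
    have h1 : R.rel (-s + t, x₀) (t, y) := by
      have := R.shift (-s + t) _ _ _ _ hs
      simpa using this
    exact ⟨fun h => R.rel.trans h (R.rel.symm h1), fun h => R.rel.trans h h1⟩
  refine ⟨⟨H, fun y => if h : ∃ s, R.rel (0, x₀) (s, y) then some (h.choose : G ⧸ H) else none⟩,
    fun t y => ?_⟩
  dsimp only
  split_ifs with h
  · rw [key _ t y h.choose_spec, Option.some.injEq]
  · simpa using fun ht => h ⟨t, ht⟩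

lemma fits_unique {x₀ : X} {R : SymDiagram G X d}
    {p q : (H : AddSubgroup G) × (X → Option (G ⧸ H))} (hp : Fits x₀ p.1 p.2 R)
    (hq : Fits x₀ q.1 q.2 R) : p = q := by
  obtain ⟨H, w⟩ := p
  obtain ⟨K, u⟩ := q
  have hmem : ∀ (H : AddSubgroup G) (w : X → Option (G ⧸ H)), Fits x₀ H w R →
      ∀ t, t ∈ H ↔ R.rel (0, x₀) (t, x₀) := fun H w h t => by
    rw [h t x₀, h.apply_base, Option.some.injEq, eq_comm, QuotientAddGroup.eq_zero_iff]
  obtain rfl : H = K := AddSubgroup.ext fun t =>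
    (hmem H w hp t).trans (hmem K u hq t).symm
  congr 1
  funext y
  refine Option.ext fun a => ?_
  obtain ⟨t, rfl⟩ := QuotientAddGroup.mk_surjective a
  exact (hp t y).symm.trans (hq t y)

/-- Every diagram is described by exactly one word. -/
lemma card_eq_sum_fits [Finite G] [Finite X] (x₀ : X) (P : SymDiagram G X d → Prop)
    [Fintype (AddSubgroup G)] [∀ H : AddSubgroup G, Fintype (X → Option (G ⧸ H))] :
    Nat.card {R : SymDiagram G X d // P R}
      = ∑ H : AddSubgroup G, ∑ w : X → Option (G ⧸ H),
          Nat.card {R : SymDiagram G X d // P R ∧ Fits x₀ H w R} := by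
  rw [← Fintype.sum_sigma (f := fun p : (H : AddSubgroup G) × (X → Option (G ⧸ H)) =>
    Nat.card {R : SymDiagram G X d // P R ∧ Fits x₀ p.1 p.2 R}), ← Nat.card_sigma]
  refine Nat.card_congr (Equiv.symm (Equiv.ofBijective (fun x => ⟨x.2.1, x.2.2.1⟩) ⟨?_, ?_⟩))
  · rintro ⟨p, R, hR, hp⟩ ⟨q, S, hS, hq⟩ heq
    obtain rfl : R = S := Subtype.ext_iff.mp heq
    obtain rfl := fits_unique hp hq
    rfl
  · rintro ⟨R, hR⟩
    obtain ⟨p, hp⟩ := exists_fits x₀ R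
    exact ⟨⟨p, R, hR, hp⟩, rfl⟩

lemma Fits.rel_iff {x₀ : X} {H : AddSubgroup G} {w : X → Option (G ⧸ H)}
    {R : SymDiagram G X d} (h : Fits x₀ H w R) {x : X} {a : G ⧸ H} (hx : w x = some a)
    (s t : G) (y : X) : R.rel (s, x) (t, y) ↔ w y = some (a + (t : G ⧸ H) - s) := by
  obtain ⟨u, rfl⟩ := QuotientAddGroup.mk_surjective a
  have h1 : R.rel (0, x₀) (u, x) := (h u x).mpr hx
  rw [R.rel_iff_shift (u - s), sub_add_cancel]
  have h2 : R.rel (u, x) (u - s + t, y) ↔ R.rel (0, x₀) (u - s + t, y) :=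
    ⟨fun h => R.rel.trans h1 h, fun h => R.rel.trans (R.rel.symm h1) h⟩
  rw [h2, h, show u - s + t = u + t - s by abel]
  rfl

lemma Fits.eq_none {x₀ : X} {H : AddSubgroup G} {w : X → Option (G ⧸ H)}
    {R : SymDiagram G X d} (h : Fits x₀ H w R) {s t : G} {x y : X} (hx : w x = none)
    (hr : R.rel (s, x) (t, y)) : w y = none := by
  cases hy : w y with
  | none => rfl
  | some b =>
    have := (h.rel_iff hy t s x).mp (R.rel.symm hr)
    rw [hx] at this
    cases this

lemma card_quotient_fiber (H : AddSubgroup G) (a : G ⧸ H) :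
    Nat.card {t : G // (t : G ⧸ H) = a} = Nat.card H := by
  obtain ⟨u, rfl⟩ := QuotientAddGroup.mk_surjective a
  refine Nat.card_congr ((Equiv.addLeft (-u)).subtypeEquiv fun t => ?_)
  rw [eq_comm]
  exact QuotientAddGroup.eq

lemma ncard_labelled [Finite G] [Finite X] (H : AddSubgroup G) (w : X → Option (G ⧸ H))
    (c : G ⧸ H) : {q : G × X | w q.2 = some ((q.1 : G ⧸ H) + c)}.ncard
      = Nat.card {x : X // w x ≠ none} * Nat.card H := by
  classical
  have : Fintype X := Fintype.ofFinite X
  have e : {q : G × X // w q.2 = some ((q.1 : G ⧸ H) + c)}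
      ≃ (x : {x : X // w x ≠ none}) × {t : G // w x = some ((t : G ⧸ H) + c)} :=
    { toFun := fun q => ⟨⟨q.1.2, by rw [q.2]; simp⟩, ⟨q.1.1, q.2⟩⟩
      invFun := fun q => ⟨(q.2.1, q.1.1), q.2.2⟩
      left_inv := fun q => rfl
      right_inv := fun q => rfl }
  rw [← Nat.card_coe_set_eq]
  refine (Nat.card_congr e).trans ?_
  rw [Nat.card_sigma, Finset.sum_congr rfl (g := fun _ => Nat.card H), Finset.sum_const,
    smul_eq_mul, Finset.card_univ, Nat.card_eq_fintype_card (α := {x : X // w x ≠ none})]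
  rintro ⟨x, hx⟩ -
  obtain ⟨a, ha⟩ := Option.ne_none_iff_exists'.mp hx
  rw [← card_quotient_fiber H (a - c)]
  refine Nat.card_congr (Equiv.subtypeEquivRight fun t => ?_)
  rw [ha, Option.some.injEq, eq_comm, eq_sub_iff_add_eq]

/-- The chord has `d` points: `|H|` at each labelled position. -/
lemma Fits.card_mul [Finite G] [Finite X] {x₀ : X} {H : AddSubgroup G}
    {w : X → Option (G ⧸ H)} {R : SymDiagram G X d} (h : Fits x₀ H w R) :
    Nat.card {x : X // w x ≠ none} * Nat.card H = d := by
  rw [← ncard_labelled H w 0, ← R.card_chord (0, x₀)]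
  congr 1
  ext ⟨t, y⟩
  refine Iff.trans ?_ (h t y).symm
  simp

/-- The diagram on the points off the orbit of the chord through `(0, x₀)`. -/
def restrict {x₀ : X} {H : AddSubgroup G} {w : X → Option (G ⧸ H)} (φ : Y ↪ X)
    (hφ : ∀ x, w x = none ↔ x ∈ Set.range φ) (R : SymDiagram G X d) (h : Fits x₀ H w R) :
    SymDiagram G Y d where
  rel := R.rel.comap (Prod.map id φ)
  shift g s t x y hr := R.shift g s t _ _ hr
  card_chord p := by
    refine Eq.trans ?_ (R.card_chord (Prod.map id φ p))
    refine Set.ncard_preimage_of_injective_subset_range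
      (s := {q | R.rel (Prod.map id φ p) q}) (Function.injective_id.prodMap φ.injective) ?_
    rintro ⟨t, x⟩ hx
    obtain ⟨y, rfl⟩ := (hφ x).mp (h.eq_none ((hφ _).mpr ⟨p.2, rfl⟩) hx)
    exact ⟨(t, y), rfl⟩

/-- The relation obtained by adding the orbit of a labelled chord to a diagram. -/
def glueRel {H : AddSubgroup G} (w : X → Option (G ⧸ H)) (φ : Y ↪ X)
    (hφ : ∀ x, w x = none ↔ x ∈ Set.range φ) (R : SymDiagram G Y d) : Setoid (G × X) where
  -- A point `(s, x)` with label `a` lies on the translate of the base chord by the class of `s -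
  -- a`.
  r p q := (∃ a b, w p.2 = some a ∧ w q.2 = some b ∧ a - (p.1 : G ⧸ H) = b - (q.1 : G ⧸ H)) ∨
    ∃ y z, φ y = p.2 ∧ φ z = q.2 ∧ R.rel (p.1, y) (q.1, z)
  iseqv :=
    { refl := fun p => by
        cases h : w p.2 with
        | some a => exact Or.inl ⟨a, a, rfl, rfl, rfl⟩
        | none =>
          obtain ⟨y, hy⟩ := (hφ _).mp h
          exact Or.inr ⟨y, y, hy, hy, R.rel.refl _⟩
      symm := by
        rintro p q (⟨a, b, h1, h2, h3⟩ | ⟨y, z, h1, h2, h3⟩)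
        · exact Or.inl ⟨b, a, h2, h1, h3.symm⟩
        · exact Or.inr ⟨z, y, h2, h1, R.rel.symm h3⟩
      trans := by
        have hne : ∀ (y : Y) (x : X) (a : G ⧸ H), φ y = x → w x ≠ some a := by
          rintro y x a rfl h
          rw [(hφ _).mpr ⟨y, rfl⟩] at h
          cases h
        rintro p q r (⟨a, b, h1, h2, h3⟩ | ⟨y, z, h1, h2, h3⟩)
          (⟨a', b', h1', h2', h3'⟩ | ⟨y', z', h1', h2', h3'⟩)
        · obtain rfl : b = a' := Option.some.inj (h2.symm.trans h1')
          exact Or.inl ⟨a, b', h1, h2', h3.trans h3'⟩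
        · exact absurd h2 (hne _ _ _ h1')
        · exact absurd h1' (hne _ _ _ h2)
        · obtain rfl : z = y' := φ.injective (h2.trans h1'.symm)
          exact Or.inr ⟨y, z', h1, h2', R.rel.trans h3 h3'⟩ }

lemma glueRel_some {H : AddSubgroup G} {w : X → Option (G ⧸ H)} {φ : Y ↪ X}
    (hφ : ∀ x, w x = none ↔ x ∈ Set.range φ) (R : SymDiagram G Y d) {x : X} {a : G ⧸ H}
    (hx : w x = some a) (s : G) (q : G × X) :
    glueRel w φ hφ R (s, x) q ↔ w q.2 = some ((q.1 : G ⧸ H) + (a - s)) := by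
  constructor
  · rintro (⟨a', b, h1, h2, h3⟩ | ⟨y, z, h1, h2, h3⟩)
    · obtain rfl : a = a' := Option.some.inj (hx.symm.trans h1)
      rw [h2, h3]
      simp
    · have : w x = none := (hφ x).mpr ⟨y, h1⟩
      rw [hx] at this
      cases this
  · intro h
    exact Or.inl ⟨a, _, hx, h, by abel⟩

lemma glueRel_apply {H : AddSubgroup G} {w : X → Option (G ⧸ H)} {φ : Y ↪ X}
    (hφ : ∀ x, w x = none ↔ x ∈ Set.range φ) (R : SymDiagram G Y d) (s t : G) (y z : Y) :
    glueRel w φ hφ R (s, φ y) (t, φ z) ↔ R.rel (s, y) (t, z) := by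
  constructor
  · rintro (⟨a', b, h1, h2, h3⟩ | ⟨y, z, h1, h2, h3⟩)
    · have : w (φ y) = none := (hφ _).mpr ⟨y, rfl⟩
      rw [this] at h1
      cases h1
    · obtain rfl := φ.injective h1
      obtain rfl := φ.injective h2
      exact h3
  · intro h
    exact Or.inr ⟨y, z, rfl, rfl, h⟩

/-- Adding the orbit of a labelled chord to a diagram. -/
def glue [Finite G] [Finite X] {H : AddSubgroup G} (w : X → Option (G ⧸ H)) (φ : Y ↪ X)
    (hφ : ∀ x, w x = none ↔ x ∈ Set.range φ)
    (hd : Nat.card {x : X // w x ≠ none} * Nat.card H = d) (R : SymDiagram G Y d) :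
    SymDiagram G X d where
  rel := glueRel w φ hφ R
  shift g s t x y := by
    rintro (⟨a, b, h1, h2, h3⟩ | ⟨y, z, h1, h2, h3⟩)
    · refine Or.inl ⟨a, b, h1, h2, ?_⟩
      rw [QuotientAddGroup.mk_add, QuotientAddGroup.mk_add, add_comm (g : G ⧸ H),
        add_comm (g : G ⧸ H), ← sub_sub, ← sub_sub]
      exact congrArg (· - (g : G ⧸ H)) h3
    · exact Or.inr ⟨y, z, h1, h2, R.shift g _ _ _ _ h3⟩
  card_chord := by
    rintro ⟨s, x⟩
    cases hx : w x with
    | some a =>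
      refine Eq.trans ?_ ((ncard_labelled H w (a - s)).trans hd)
      congr 1
      ext q
      exact glueRel_some hφ R hx s q
    | none =>
      obtain ⟨y, rfl⟩ := (hφ _).mp hx
      refine Eq.trans ?_ ((Set.ncard_image_of_injective _
        (Function.injective_id.prodMap φ.injective :
          Function.Injective (Prod.map (id : G → G) φ))).trans (R.card_chord (s, y)))
      congr 1
      ext ⟨t, x⟩
      constructor
      · intro h
        obtain ⟨a, b, h1, -⟩ | ⟨y', z, h1, h2, h3⟩ := id h
        · rw [hx] at h1
          cases h1
        · obtain rfl := φ.injective h1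
          exact ⟨(t, z), h3, Prod.ext rfl h2⟩
      · rintro ⟨⟨t', z⟩, h, heq⟩
        obtain ⟨rfl, rfl⟩ := Prod.mk.inj heq
        exact (glueRel_apply hφ R _ _ _ _).mpr h

/-- Diagrams described by a given word correspond to diagrams on the points off the clique. -/
def fitsEquiv [Finite G] [Finite X] (x₀ : X) {H : AddSubgroup G} (w : X → Option (G ⧸ H))
    (φ : Y ↪ X) (hφ : ∀ x, w x = none ↔ x ∈ Set.range φ) (h0 : w x₀ = some 0)
    (hd : Nat.card {x : X // w x ≠ none} * Nat.card H = d) :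
    {R : SymDiagram G X d // Fits x₀ H w R} ≃ SymDiagram G Y d where
  toFun R := R.1.restrict φ hφ R.2
  invFun R := ⟨R.glue w φ hφ hd, fun t y => by
    refine (glueRel_some hφ R h0 0 (t, y)).trans ?_
    simp⟩
  left_inv R := by
    refine Subtype.ext (SymDiagram.ext (Setoid.ext ?_))
    rintro ⟨s, x⟩ ⟨t, z⟩
    cases hx : w x with
    | some a =>
      refine (glueRel_some hφ _ hx s (t, z)).trans ?_
      rw [R.2.rel_iff hx, add_sub_assoc', add_comm a]
    | none =>
      obtain ⟨y, rfl⟩ := (hφ _).mp hx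
      cases hz : w z with
      | some b =>
        refine iff_of_false ?_ ?_
        · intro h
          have := (glueRel_some hφ _ hz t (s, φ y)).mp (Setoid.symm' _ h)
          rw [hx] at this
          cases this
        · intro h
          have := R.2.eq_none hx h
          rw [hz] at this
          cases this
      | none =>
        obtain ⟨z, rfl⟩ := (hφ _).mp hz
        exact glueRel_apply hφ _ s t y z
  right_inv R := by
    refine SymDiagram.ext (Setoid.ext ?_)
    rintro ⟨s, x⟩ ⟨t, z⟩
    exact glueRel_apply hφ R s t x z

end SymDiagram

/-! ### Loops before and after removing the orbit -/

namespace SymDiagram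
variable {G : Type*} [AddCommGroup G] {d : ℕ}

open Classical in
/-- For each point of a sector, whether it forms a loop with the point before it. -/
noncomputable def flags {V : ℕ} (R : SymDiagram G (Fin V) d) : List Bool :=
  -- Entry `0` is always false: the first point has no predecessor in its sector.
  (List.range V).map fun j => decide (∃ i, j = i + 1 ∧ R.IsLoop i)

lemma length_flags {V : ℕ} (R : SymDiagram G (Fin V) d) : R.flags.length = V := by
  simp [flags]

lemma flags_getElem?_succ {V : ℕ} (R : SymDiagram G (Fin V) d) (j : ℕ) :
    R.flags[j + 1]? = some false ↔ j + 1 < V ∧ ¬ R.IsLoop j := by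
  by_cases h : j + 1 < V
  · simp [flags, h]
  · simp [flags, h]

lemma count_map_range (n : ℕ) (p : ℕ → Prop) [DecidablePred p] :
    ((List.range n).map fun j => decide (p j)).count true = Nat.count p n := by
  induction n with
  | zero => simp
  | succ n ih =>
    rw [List.range_succ, List.map_append, List.count_append, ih, Nat.count_succ]
    by_cases h : p n <;> simp [h]

lemma count_tail_flags {V : ℕ} (R : SymDiagram G (Fin V) d) :
    R.flags.tail.count true = R.loops := by
  classical
  cases V with
  | zero =>
    have : R.loops = 0 := R.loops_eq_zero_iff.mpr fun i ⟨h, _⟩ => by omega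
    simp [flags, this]
  | succ V =>
    have h1 : R.flags.tail = (List.range V).map fun j => decide (R.IsLoop j) := by
      simp [flags, List.range_succ_eq_map, Function.comp_def]
    rw [h1, count_map_range, Nat.count_eq_card_filter_range, loops, ← Set.ncard_coe_finset]
    congr 1
    ext i
    simp only [Finset.coe_filter, Finset.mem_range, Set.mem_ofPred_eq]
    exact ⟨fun h => h.2, fun h => ⟨by have := h.1; omega, h⟩⟩

/-- Extension of a finite word by `none`. -/
def extendWord {L : Type*} {v : ℕ} (w : Fin v → Option L) (k : ℕ) : Option L :=
  if h : k < v then w ⟨k, h⟩ else none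

lemma extendWord_of_lt {L : Type*} {v : ℕ} (w : Fin v → Option L) {k : ℕ} (h : k < v) :
    extendWord w k = w ⟨k, h⟩ := dif_pos h

section
variable {L : Type*} [DecidableEq L] {v : ℕ} (w : Fin v → Option L)

/-- With infinitely many `none`s, `Nat.nth` enumerates them injectively without a default value. -/
lemma infinite_extendWord : (Set.ofPred fun k => extendWord w k = none).Infinite := by
  refine Set.infinite_of_not_bddAbove fun ⟨b, hb⟩ => ?_
  have : b + v + 1 ≤ b := hb (show extendWord w (b + v + 1) = none from dif_neg (by omega))
  omega

/-- The increasing enumeration of the positions with the letter `none`. -/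
noncomputable def nonesEmb {V : ℕ} (hV : Nat.count (fun k => extendWord w k = none) v = V) :
    Fin V ↪ Fin v where
  toFun j := ⟨Nat.nth (fun k => extendWord w k = none) j, Nat.nth_lt_of_lt_count (hV ▸ j.2)⟩
  inj' j j' h := Fin.ext
    (Nat.nth_injective (infinite_extendWord w) (congrArg Fin.val h))

lemma nonesEmb_count {V : ℕ} (hV : Nat.count (fun k => extendWord w k = none) v = V)
    {i : ℕ} (hi : i < v) (h : extendWord w i = none)
    (hc : Nat.count (fun k => extendWord w k = none) i < V) :
    nonesEmb w hV ⟨Nat.count (fun k => extendWord w k = none) i, hc⟩ = ⟨i, hi⟩ :=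
  Fin.ext (Nat.nth_count h)

lemma count_extendWord_lt {V : ℕ} (hV : Nat.count (fun k => extendWord w k = none) v = V)
    {i : ℕ} (hi : i < v) (h : extendWord w i = none) :
    Nat.count (fun k => extendWord w k = none) i < V := by
  rw [← hV]
  exact Nat.count_strict_mono h hi

lemma nonesEmb_range {V : ℕ} (hV : Nat.count (fun k => extendWord w k = none) v = V)
    (x : Fin v) : w x = none ↔ x ∈ Set.range (nonesEmb w hV) := by
  constructor
  · intro h
    have h' : extendWord w x = none := (extendWord_of_lt w x.2).trans h
    exact ⟨⟨_, count_extendWord_lt w hV x.2 h'⟩, nonesEmb_count w hV x.2 h' _⟩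
  · rintro ⟨j, rfl⟩
    rw [← extendWord_of_lt w (nonesEmb w hV j).2]
    exact Nat.nth_mem_of_infinite (infinite_extendWord w) j

lemma card_some_add_count :
    Nat.card {x : Fin v // w x ≠ none} + Nat.count (fun k => extendWord w k = none) v = v := by
  have h1 : Nat.card {x : Fin v // w x = none} = Nat.count (fun k => extendWord w k = none) v := by
    have e : {x : Fin v // w x = none} = Set.range (nonesEmb w rfl) := by
      congr 1
      ext x
      exact nonesEmb_range w rfl x
    rw [e, Nat.card_range_of_injective (nonesEmb w rfl).injective, Nat.card_fin]
  have h2 := Nat.card_congr (Equiv.sumCompl fun x : Fin v => w x = none)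
  rw [Nat.card_sum, h1, Nat.card_fin] at h2
  rw [add_comm]
  exact h2
end

open Classical in
/-- The conditions on the loops of a diagram, in terms of the word of the chord through the first
point and of the rest of the diagram. -/
lemma loops_and_boundary_iff {n V : ℕ} (g : G) {H : AddSubgroup G}
    {w : Fin (n + 1) → Option (G ⧸ H)} {R : SymDiagram G (Fin (n + 1)) d}
    (h : Fits 0 H w R) (hV : Nat.count (fun k => extendWord w k = none) (n + 1) = V) :
    (R.loops = 0 ∧ R.rel (0, Fin.last n) (g, 0)) ↔
      WordOk ((-g : G) : G ⧸ H)
        (R.restrict (nonesEmb w hV) (nonesEmb_range w hV) h).flags (some 0)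
        (List.ofFn fun i : Fin n => w i.succ) := by
  have hw0 : extendWord w 0 = some 0 := (extendWord_of_lt w n.succ_pos).trans h.apply_base
  have hlist : (List.ofFn fun i : Fin n => w i.succ)
      = List.ofFn fun i : Fin n => extendWord w (i + 1) := by
    congr 1
    funext i
    exact (extendWord_of_lt w i.succ.2).symm
  have hcount : ∀ i, Nat.count (fun k => extendWord w (k + 1) = none) i
      = Nat.count (fun k => extendWord w k = none) (i + 1) := fun i => by
    rw [Nat.count_succ', hw0]
    simp
  rw [hlist, ← hw0, wordOk_ofFn_iff, and_comm, length_flags, loops_eq_zero_iff]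
  refine and_congr ?_ ?_
  -- The boundary relation says that the last label is `-g`.
  · rw [extendWord_of_lt w n.lt_succ_self, Setoid.comm' R.rel, h.rel_iff h.apply_base]
    simp
    rfl
  · rw [hcount, hV, eq_self_iff_true, true_and]
    have hloop : (∀ i, ¬ R.IsLoop i) ↔ ∀ i, ∀ hi : i < n,
        ¬ R.rel (0, ⟨i, by omega⟩) (0, ⟨i + 1, by omega⟩) :=
      ⟨fun h i hi hr => h i ⟨by omega, hr⟩, fun h i ⟨hi, hr⟩ => h i (by omega) hr⟩
    rw [hloop]
    refine forall_congr' fun i => forall_congr' fun hi => ?_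
    rw [hcount]
    -- Two adjacent labelled points form a loop iff their labels agree; a labelled and an unlabelled
    -- point never do; two unlabelled ones are consecutive in the reduced diagram, where the flag
    -- decides.
    cases hwi : extendWord w i with
    | some a =>
      have hwi' := (extendWord_of_lt w (by omega : i < n + 1)).symm.trans hwi
      rw [h.rel_iff hwi', extendWord_of_lt w (by omega : i + 1 < n + 1)]
      simp
    | none =>
      have hwi' := (extendWord_of_lt w (by omega : i < n + 1)).symm.trans hwi
      cases hwj : extendWord w (i + 1) with
      | some b =>
        have hwj' := (extendWord_of_lt w (by omega : i + 1 < n + 1)).symm.trans hwj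
        simp only [reduceCtorEq, false_implies, forall_const, and_self, iff_true]
        intro hr
        rw [h.eq_none hwi' hr] at hwj'
        cases hwj'
      | none =>
        have hsucc : Nat.count (fun k => extendWord w k = none) (i + 1)
            = Nat.count (fun k => extendWord w k = none) i + 1 := by
          rw [Nat.count_succ, if_pos hwi]
        have hlt := count_extendWord_lt w hV (by omega : i + 1 < n + 1) hwj
        have e1 := nonesEmb_count w hV (by omega : i < n + 1) hwi
          (count_extendWord_lt w hV (by omega) hwi)
        have e2 := nonesEmb_count w hV (by omega : i + 1 < n + 1) hwj hlt
        simp only [hsucc] at e2 hlt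
        rw [hsucc, flags_getElem?_succ]
        simp only [reduceCtorEq, false_implies, implies_true, and_true, forall_const, hlt,
          true_and]
        refine not_congr ?_
        rw [← e1, ← e2]
        exact ⟨fun hr => ⟨hlt, hr⟩, fun ⟨_, hr⟩ => hr⟩

lemma card_fits_eq [Finite G] {n V e : ℕ} (g : G) (H : AddSubgroup G)
    (w : Fin (n + 1) → Option (G ⧸ H)) (hVe : n + 1 = V + e) (he : e * Nat.card H = d) :
    Nat.card {R : SymDiagram G (Fin (n + 1)) d //
        (R.loops = 0 ∧ R.rel (0, Fin.last n) (g, 0)) ∧ Fits 0 H w R}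
      = Nat.card {R : SymDiagram G (Fin V) d // w 0 = some 0 ∧
          WordOk ((-g : G) : G ⧸ H) R.flags (some 0) (List.ofFn fun i : Fin n => w i.succ)} := by
  classical
  have hsum := card_some_add_count w
  have hH : 0 < Nat.card H := Nat.card_pos
  by_cases h0 : w 0 = some 0
  · by_cases hV : Nat.count (fun k => extendWord w k = none) (n + 1) = V
    · have hd : Nat.card {x : Fin (n + 1) // w x ≠ none} * Nat.card H = d := by
        rw [← he]
        congr 1
        omega
      refine Nat.card_congr (((Equiv.subtypeEquivRight fun R => and_comm).trans
        (Equiv.subtypeSubtypeEquivSubtypeInter (fun R : SymDiagram G (Fin (n + 1)) d =>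
          Fits 0 H w R) _).symm).trans ((fitsEquiv 0 w (nonesEmb w hV) (nonesEmb_range w hV) h0
            hd).subtypeEquiv fun R => ?_))
      rw [loops_and_boundary_iff g R.2 hV]
      exact (and_iff_right h0).symm
    -- With a wrong number of `none`s both sides are empty: the chord size fixes this number on the
    -- left, the number of flags on the right.
    · have h1 : IsEmpty {R : SymDiagram G (Fin (n + 1)) d //
          (R.loops = 0 ∧ R.rel (0, Fin.last n) (g, 0)) ∧ Fits 0 H w R} := by
        refine ⟨fun R => hV ?_⟩
        have h2 := R.2.2.card_mul
        have h3 := Nat.eq_of_mul_eq_mul_right hH (h2.trans he.symm)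
        omega
      have h2 : IsEmpty {R : SymDiagram G (Fin V) d // w 0 = some 0 ∧
          WordOk ((-g : G) : G ⧸ H) R.flags (some 0) (List.ofFn fun i : Fin n => w i.succ)} := by
        refine ⟨fun ⟨R, _, h3⟩ => hV ?_⟩
        have hlist : (List.ofFn fun i : Fin n => w i.succ)
            = List.ofFn fun i : Fin n => extendWord w (i + 1) := by
          congr 1
          funext i
          exact (extendWord_of_lt w i.succ.2).symm
        have hw0 : extendWord w 0 = some 0 := (extendWord_of_lt w n.succ_pos).trans h0
        rw [hlist, ← hw0, wordOk_ofFn_iff, length_flags] at h3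
        rw [Nat.count_succ', hw0, ← h3.2.1]
        simp
      rw [Nat.card_of_isEmpty, Nat.card_of_isEmpty]
  · have h1 : IsEmpty {R : SymDiagram G (Fin (n + 1)) d //
        (R.loops = 0 ∧ R.rel (0, Fin.last n) (g, 0)) ∧ Fits 0 H w R} :=
      ⟨fun R => h0 R.2.2.apply_base⟩
    have h2 : IsEmpty {R : SymDiagram G (Fin V) d // w 0 = some 0 ∧
        WordOk ((-g : G) : G ⧸ H) R.flags (some 0) (List.ofFn fun i : Fin n => w i.succ)} :=
      ⟨fun R => h0 R.2.1⟩
    rw [Nat.card_of_isEmpty, Nat.card_of_isEmpty]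

end SymDiagram

/-! ### Summation over words, reduced diagrams and subgroups -/

lemma sum_card_comm {A B : Type*} [Fintype A] [Fintype B] (P : A → B → Prop) :
    ∑ a, Nat.card {b // P a b} = ∑ b, Nat.card {a // P a b} := by
  rw [← Nat.card_sigma, ← Nat.card_sigma]
  exact Nat.card_congr
    { toFun := fun x => ⟨x.2.1, x.1, x.2.2⟩
      invFun := fun x => ⟨x.2.1, x.1, x.2.2⟩
      left_inv := fun _ => rfl
      right_inv := fun _ => rfl }

namespace SymDiagram
variable {G : Type*} [AddCommGroup G] {d : ℕ}

lemma sum_card_fits_eq [Finite G] {n V e : ℕ} (g : G) (H : AddSubgroup G)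
    [Fintype (Fin (n + 1) → Option (G ⧸ H))] [Fintype (SymDiagram G (Fin V) d)]
    (hVe : n + 1 = V + e) (he : e * Nat.card H = d) :
    ∑ w : Fin (n + 1) → Option (G ⧸ H), Nat.card {R : SymDiagram G (Fin (n + 1)) d //
        (R.loops = 0 ∧ R.rel (0, Fin.last n) (g, 0)) ∧ Fits 0 H w R}
      = ∑ R : SymDiagram G (Fin V) d, wordCount ((-g : G) : G ⧸ H) R.flags (some 0) n := by
  rw [Finset.sum_congr rfl fun w _ => card_fits_eq g H w hVe he, sum_card_comm]
  exact Finset.sum_congr rfl fun R _ => card_fun_cons_eq n (some 0) _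

/-- The number of words depends on the reduced diagram only through its loop count `k`, and vanishes
for `k > e - 2`. If `V = 0`, `hg` makes the first label `0` and the last label `-g` differ. -/
lemma sum_wordCount_eq [Finite G] {n V e : ℕ} (g : G) (H : AddSubgroup G)
    [Fintype (SymDiagram G (Fin V) d)] (hVe : n + 1 = V + e) (he : 1 ≤ e)
    (hg : V ≠ 0 ∨ g ∉ H) :
    ((∑ R : SymDiagram G (Fin V) d, wordCount ((-g : G) : G ⧸ H) R.flags (some 0) n : ℕ) : ℚ)
      = ∑ k ∈ Finset.range (e - 1), (H.index : ℚ) ^ k / ((e - 2 - k).factorial : ℚ)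
          * pNum H.index (n + 1 : ℕ) e k (e - 2 - k)
          * (Nat.card {R : SymDiagram G (Fin V) d // R.loops = k} : ℚ) := by
  classical
  have : Fintype (G ⧸ H) := Fintype.ofFinite _
  have hidx : Fintype.card (G ⧸ H) = H.index := Nat.card_eq_fintype_card.symm
  have hflags : ∀ R : SymDiagram G (Fin V) d,
      (wordCount ((-g : G) : G ⧸ H) R.flags (some 0) n : ℚ)
        = ∑ k ∈ Finset.range (e - 1), if R.loops = k then
          (H.index : ℚ) ^ k / ((e - 2 - k).factorial : ℚ)
          * pNum H.index (n + 1 : ℕ) e k (e - 2 - k) else 0 := fun R => by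
    have hlen := R.length_flags
    have h1 := wordCount_some_eq ((-g : G) : G ⧸ H) 0 R.flags
      (hg.imp (fun h h' => h (by rw [← hlen, h', List.length_nil])) fun h h' => h (by
        rw [eq_comm, QuotientAddGroup.eq_zero_iff] at h'
        simpa using h')) (n + 1) e he (by rw [hlen, hVe])
    rw [count_tail_flags, hidx] at h1
    rw [Nat.add_sub_cancel] at h1
    rw [h1, Finset.sum_ite_eq]
    simp only [Finset.mem_range]
    exact if_congr (by omega) rfl rfl
  rw [Nat.cast_sum, Finset.sum_congr rfl fun R _ => hflags R, Finset.sum_comm]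
  refine Finset.sum_congr rfl fun k _ => ?_
  rw [← Finset.sum_filter, Finset.sum_const, nsmul_eq_mul, mul_comm, Nat.card_eq_fintype_card,
    Fintype.card_subtype]

end SymDiagram

lemma sum_addSubgroup_zmod {M : Type*} [AddCommMonoid M] (m : ℕ) [NeZero m]
    [Fintype (AddSubgroup (ZMod m))] (f : ℕ → M) :
    ∑ H : AddSubgroup (ZMod m), f H.index = ∑ l ∈ m.divisors, f l := by
  classical
  refine Finset.sum_bij (fun H _ => H.index) ?_ ?_ ?_ fun _ _ => rfl
  · intro H _
    refine Nat.mem_divisors.mpr ⟨?_, NeZero.ne m⟩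
    have := H.index_dvd_card
    rwa [Nat.card_zmod] at this
  -- A cyclic group has at most `|H|` elements killed by `|H|`, so `H` consists of exactly these and
  -- is determined by its order.
  · have key : ∀ H : AddSubgroup (ZMod m),
        (H : Set (ZMod m)) = {x | Nat.card H • x = 0} := fun H => by
      have hsub : (H : Set (ZMod m)) ⊆ {x | Nat.card H • x = 0} := fun x hx => by
        have := card_nsmul_eq_zero' (x := (⟨x, hx⟩ : H))
        exact congrArg Subtype.val this
      refine Set.eq_of_subset_of_ncard_le hsub ?_
      have h1 := IsAddCyclic.card_nsmul_eq_zero_le (α := ZMod m) (n := Nat.card H) Nat.card_pos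
      rw [← Nat.card_coe_set_eq (H : Set (ZMod m))]
      refine le_trans (le_of_eq ?_) h1
      rw [← Set.ncard_coe_finset]
      simp
    intro H _ K _ h
    have h1 := H.card_mul_index
    have h2 := K.card_mul_index
    have hpos : 0 < K.index := Nat.pos_of_ne_zero K.index_ne_zero_of_finite
    have hc : Nat.card H = Nat.card K := by
      rw [show H.index = K.index from h, ← h2] at h1
      exact Nat.eq_of_mul_eq_mul_right hpos h1
    apply SetLike.coe_injective
    rw [key H, key K, hc]
  · intro l hl
    obtain ⟨c, hc⟩ := Nat.dvd_of_mem_divisors hl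
    have hm : 0 < m := NeZero.pos m
    have hl0 : 0 < l := Nat.pos_of_mem_divisors hl
    refine ⟨AddSubgroup.zmultiples (l : ZMod m), Finset.mem_univ _, ?_⟩
    have h1 := (AddSubgroup.zmultiples (l : ZMod m)).card_mul_index
    have hc0 : 0 < c := Nat.pos_of_ne_zero (by rintro rfl; omega)
    have hcard : Nat.card (AddSubgroup.zmultiples (l : ZMod m)) = c := by
      rw [Nat.card_zmultiples, ZMod.addOrderOf_coe l hm.ne', Nat.gcd_eq_right (Dvd.intro c hc.symm)]
      exact Nat.div_eq_of_eq_mul_right hl0 hc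
    rw [hcard, Nat.card_zmod] at h1
    refine Nat.eq_of_mul_eq_mul_left hc0 (h1.trans ?_)
    rw [hc, mul_comm]

/-- The number of diagrams without loops in the sectors but with loops between the sectors. -/
lemma card_boundary_loops (m n d v N : ℕ) [NeZero m] (hn : 2 ≤ n) (hd : 1 ≤ d) (hv : v = N + 1)
    (hmv : m * v = d * n) :
    (Nat.card {R : SymDiagram (ZMod m) (Fin (N + 1)) d //
        R.loops = 0 ∧ R.rel (0, Fin.last N) (1, 0)} : ℚ)
      = ∑ l ∈ m.divisors with m ∣ l * d,
          ∑ k ∈ Finset.range (l * d / m - 1),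
            (l : ℚ) ^ k / ((l * d / m - 2 - k).factorial : ℚ)
              * pNum l v ((l * d / m : ℕ) : ℤ) k (l * d / m - 2 - k)
              * (numLinear m d ((v : ℤ) - ((l * d / m : ℕ) : ℤ)) k : ℚ) := by
  classical
  have : Fintype (AddSubgroup (ZMod m)) := Fintype.ofFinite _
  have (H : AddSubgroup (ZMod m)) : Fintype (Fin (N + 1) → Option (ZMod m ⧸ H)) :=
    Fintype.ofFinite _
  have hm : 0 < m := NeZero.pos m
  rw [SymDiagram.card_eq_sum_fits (0 : Fin (N + 1)), Finset.sum_filter, ← sum_addSubgroup_zmod,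
    Nat.cast_sum]
  refine Finset.sum_congr rfl fun H _ => ?_
  have hidx : H.index * Nat.card H = m := by rw [H.index_mul_card, Nat.card_zmod]
  have hl : 0 < H.index := Nat.pos_of_ne_zero H.index_ne_zero_of_finite
  have hH : 0 < Nat.card H := Nat.card_pos
  split_ifs with hdvd
  · set e := H.index * d / m with he
    have heH : e * Nat.card H = d := by
      have h1 : m * e = H.index * d := Nat.mul_div_cancel' hdvd
      refine Nat.eq_of_mul_eq_mul_left hl ?_
      calc H.index * (e * Nat.card H) = H.index * Nat.card H * e := by ring
        _ = H.index * d := by rw [hidx, h1]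
    have he1 : 1 ≤ e := Nat.pos_of_ne_zero (by rintro h; rw [h] at heH; omega)
    rcases Nat.lt_or_ge v e with hve | hve
    · rw [Finset.sum_eq_zero, Finset.sum_eq_zero]
      · simp
      · intro k _
        rw [numLinear, if_neg (by omega)]
        simp
      · intro w _
        have : IsEmpty {R : SymDiagram (ZMod m) (Fin (N + 1)) d //
            (R.loops = 0 ∧ R.rel (0, Fin.last N) (1, 0)) ∧ SymDiagram.Fits 0 H w R} := by
          refine ⟨fun R => ?_⟩
          have h1 := Nat.eq_of_mul_eq_mul_right hH (R.2.2.card_mul.trans heH.symm)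
          have h2 := SymDiagram.card_some_add_count w
          omega
        exact Nat.card_of_isEmpty
    · obtain ⟨V, hV⟩ : ∃ V, v = V + e := ⟨v - e, by omega⟩
      have : Fintype (SymDiagram (ZMod m) (Fin V) d) := Fintype.ofFinite _
      rw [SymDiagram.sum_card_fits_eq (V := V) (e := e) 1 H (by omega) heH,
        SymDiagram.sum_wordCount_eq 1 H (by omega) he1]
      · refine Finset.sum_congr rfl fun k _ => ?_
        rw [show (v : ℤ) - (e : ℤ) = (V : ℤ) by rw [hV]; push_cast; ring, numLinear_eq, hv]
      -- If `V = 0` and `1 ∈ H`, then `H` is everything and one chord covers the circle, so `mv =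
      -- d`, against `n ≥ 2`.
      · rw [or_iff_not_imp_left, not_not]
        intro hV0 h1
        have htop : H = ⊤ := by
          refine (AddSubgroup.eq_top_iff' H).mpr fun x => ?_
          have := H.nsmul_mem h1 x.val
          rwa [nsmul_one, ZMod.natCast_zmod_val] at this
        rw [htop, AddSubgroup.card_top, Nat.card_zmod] at heH
        rw [hV, hV0, zero_add, mul_comm, heH] at hmv
        have : d * 2 ≤ d * n := Nat.mul_le_mul_left d hn
        omega
  -- Since `e * |H| = d` and `l * |H| = m`, a stabiliser of index `l` forces `m ∣ l * d`.
  · rw [Finset.sum_eq_zero, Nat.cast_zero]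
    intro w _
    have : IsEmpty {R : SymDiagram (ZMod m) (Fin (N + 1)) d //
        (R.loops = 0 ∧ R.rel (0, Fin.last N) (1, 0)) ∧ SymDiagram.Fits 0 H w R} := by
      refine ⟨fun R => hdvd ?_⟩
      have h1 : H.index * Nat.card H ∣ H.index * d :=
        Nat.mul_dvd_mul_left _ (Dvd.intro_left _ R.2.2.card_mul)
      rwa [hidx] at h1
    exact Nat.card_of_isEmpty

theorem mainTheorem6 (n d : ℕ) (hn : 1 ≤ n) (hd : 1 ≤ d) :
    -- a rotation of order `m` fixes exactly `f(dn, m)` loopless diagrams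
    (∀ m : ℕ, m ∣ d * n → ∀ g ∈ rotationGroup (d * n), orderOf g = m →
      Nat.card {D : ChordDiagram (d * n) d // D.IsLoopless ∧ g • D = D}
        = numSymmetricLoopless d (d * n) m) ∧
    -- the number of loopless diagrams up to rotation
    (numUpToRotation n d : ℚ)
      = 1 / ((d : ℚ) * n) * ∑ m ∈ (d * n).divisors,
          (Nat.totient m : ℚ) * (numSymmetricLoopless d (d * n) m : ℚ) ∧
    -- the formula for `f(dn, m)`, with `v = dn / m` and `e = ld / m`
    (2 ≤ n → ∀ m v : ℕ, m * v = d * n →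
      (numSymmetricLoopless d (d * n) m : ℚ)
        = (numLinear m d v 0 : ℚ)
          - ∑ l ∈ m.divisors with m ∣ l * d,
              ∑ k ∈ Finset.range (l * d / m - 1),
                (l : ℚ) ^ k / ((l * d / m - 2 - k).factorial : ℚ)
                  * pNum l v ((l * d / m : ℕ) : ℤ) k (l * d / m - 2 - k)
                  * (numLinear m d ((v : ℤ) - ((l * d / m : ℕ) : ℤ)) k : ℚ)) := by
  have hN : 1 ≤ d * n := Nat.mul_pos hd hn
  refine ⟨fun m hm g hg hgm => card_fixed_loopless hN hm hg hgm, numUpToRotation_eq n d hn hd,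
    fun hn2 m v hmv => ?_⟩
  have hm : m ≠ 0 := by rintro rfl; omega
  have hv : v ≠ 0 := by rintro rfl; omega
  have : NeZero m := ⟨hm⟩
  have h2 : 2 ≤ m * v := by rw [hmv]; nlinarith
  obtain ⟨N, hvN⟩ := Nat.exists_eq_succ_of_ne_zero hv
  have key := card_boundary_loops m n d v N hn2 hd hvN hmv
  rw [← key, ← hmv]
  subst hvN
  have h3 := numSymmetricLoopless_add m (N + 1) d N.succ_pos h2
  rw [eq_sub_iff_add_eq, ← h3, Nat.cast_add]
  rfl
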